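/- All graphs are finite and simple. For a vertex $v$ of a graph $G$, the local complementation $G*v$ is obtained from $G$ by toggling the adjacency of every pair of distinct neighbors of $v$; two graphs are locally equivalent if one can be obtained from the other by a sequence of local complementations. For an edge $vw$ let $G\wedge vw=G*v*w*v$; let $G\setminus v$ be $G$ with $v$ deleted, and let $G/v$ be $G\setminus v$ if $v$ has no neighbor and $(G\wedge vw)\setminus v$ for an arbitrary neighbor $w$ of $v$ otherwise (this is well defined up to local equivalence). A graph is prime if it has no split, i.e. no partition $(A,B)$ of its vertex set with $|A|,|B|\ge 2$ and with subsets $A'\subseteq A$, $B'\subseteq B$ such that $x\in A$ and $y\in B$ are adjacent if and only if $x\in A'$ and $y\in B'$. A vertex $v$ of $G$ is non-essential if at least two of $G\setminus v$, $G*v\setminus v$, $G/v$ are prime. For $m\ge 1$ and positive integers $\ell_1,\dots,\ell_m$, at most one of which equals $1$, let $\theta(\ell_1,\dots,\ell_m)$ be the graph with two specified vertices $x\neq y$ consisting of $m$ internally disjoint paths from $x$ to $y$ of lengths $\ell_1,\dots,\ell_m$. **Proposition.** Let $G$ be a prime graph with at least $5$ vertices. If $G$ has at most $2$ non-essential vertices,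 then $G$ is locally equivalent to a graph isomorphic to $\theta(\ell_1,\dots,\ell_m)$ for some $m\ge 1$ and some positive integers $\ell_1,\dots,\ell_m$, at most one of which equals $1$. -/

import Mathlib

universe u

namespace SimpleGraph

/-- The local complementation `G * v`: toggle the adjacency of every pair of
distinct neighbors of `v`. -/
def localComplement {V : Type u} (G : SimpleGraph V) (v : V) : SimpleGraph V where
  Adj x y := x ≠ y ∧ Xor (G.Adj x y) (G.Adj v x ∧ G.Adj v y)
  symm := ⟨fun x y h => ⟨h.1.symm, by
    rw [G.adj_comm y x, and_comm (a := G.Adj v y)]; exact h.2⟩⟩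
  loopless := ⟨fun _ h => h.1 rfl⟩

/-- `H` is obtained from `G` by a (possibly empty) finite sequence of local complementations. -/
def LocallyEquivalent {V : Type u} (G H : SimpleGraph V) : Prop :=
  Relation.ReflTransGen (fun G₁ G₂ : SimpleGraph V => ∃ v, G₂ = G₁.localComplement v) G H

/-- Pivoting: `G ∧ vw = G * v * w * v` (used when `vw` is an edge of `G`). -/
def pivot {V : Type u} (G : SimpleGraph V) (v w : V) : SimpleGraph V :=
  ((G.localComplement v).localComplement w).localComplement v

/-- Vertex deletion `G \ v`, a graph on the vertices different from `v`. -/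
def deleteVertex {V : Type u} (G : SimpleGraph V) (v : V) :
    SimpleGraph (({v}ᶜ : Set V) : Type u) :=
  G.induce ({v}ᶜ : Set V)

open Classical in
/-- `G / v`: this is `G \ v` if `v` is isolated, and `(G ∧ vw) \ v` for an
arbitrarily chosen neighbor `w` of `v` otherwise. -/
noncomputable def contractVertex {V : Type u} (G : SimpleGraph V) (v : V) :
    SimpleGraph (({v}ᶜ : Set V) : Type u) :=
  if h : ∃ w, G.Adj v w then (G.pivot v h.choose).deleteVertex v else G.deleteVertex v

/-- The partition `(A, Aᶜ)` of the vertex set is a split of `G`. -/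
def IsSplit {V : Type u} (G : SimpleGraph V) (A : Set V) : Prop :=
  2 ≤ A.encard ∧ 2 ≤ Aᶜ.encard ∧
    ∃ A' ⊆ A, ∃ B' ⊆ Aᶜ, ∀ x ∈ A, ∀ y ∈ Aᶜ, (G.Adj x y ↔ x ∈ A' ∧ y ∈ B')

/-- A graph is prime (for split decomposition) if it has no split. -/
def IsSplitPrime {V : Type u} (G : SimpleGraph V) : Prop :=
  ∀ A : Set V, ¬ G.IsSplit A

/-- `v` is non-essential: at least two of `G \ v`, `G * v \ v`, `G / v` are prime. -/
def IsNonEssential {V : Type u} (G : SimpleGraph V) (v : V) : Prop :=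
  ((G.deleteVertex v).IsSplitPrime ∧ ((G.localComplement v).deleteVertex v).IsSplitPrime) ∨
  ((G.deleteVertex v).IsSplitPrime ∧ (G.contractVertex v).IsSplitPrime) ∨
  (((G.localComplement v).deleteVertex v).IsSplitPrime ∧ (G.contractVertex v).IsSplitPrime)

/-- Vertices of the theta graph: the two ends `x = Sum.inl false` and `y = Sum.inl true`, and
for every `i` the `ℓ i - 1` internal vertices of the `i`-th path. -/
abbrev ThetaVertex {m : ℕ} (ℓ : Fin m → ℕ) : Type :=
  Bool ⊕ (Σ i : Fin m, Fin (ℓ i - 1))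

/-- The `j`-th vertex of the `i`-th path from `x` to `y`, for `0 ≤ j ≤ ℓ i`:
`x` for `j = 0`, `y` for `j = ℓ i`, and an internal vertex in between. -/
def thetaPathVertex {m : ℕ} (ℓ : Fin m → ℕ) (i : Fin m) (j : ℕ) : ThetaVertex ℓ :=
  if j = 0 then Sum.inl false
  else if h : j - 1 < ℓ i - 1 then Sum.inr ⟨i, ⟨j - 1, h⟩⟩
  else Sum.inl true

/-- `θ(ℓ₁, …, ℓₘ)`: two ends joined by `m` internally disjoint paths of lengths `ℓ₁, …, ℓₘ`
(meant for positive `ℓ i`, at most one of which is `1`). -/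
def thetaGraph {m : ℕ} (ℓ : Fin m → ℕ) : SimpleGraph (ThetaVertex ℓ) :=
  fromRel fun a b => ∃ i : Fin m, ∃ j : ℕ, j < ℓ i ∧
    a = thetaPathVertex ℓ i j ∧ b = thetaPathVertex ℓ i (j + 1)

end SimpleGraph

set_option linter.unusedSectionVars false

namespace PrimeVertexMinor

open Finset Module SimpleGraph

/-! Attach to G, with adjacency matrix M over the field with two elements, the space L of all
vectors (s, Ms), with entries in the plane F₂². It is Lagrangian for the symplectic form, and |A|
minus the dimension of the vectors of L supported on A (`conn`) is the cut-rank of A. Local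
complementation only applies linear automorphisms of the plane at single vertices, and the three
minors at v correspond to the three nonzero values (0,1), (1,1), (1,0) at v. The statement thus
becomes one about L, where a prime code behaves much like a 3-connected matroid and the vectors of L
with three-point support play the role of triangles and triads.

It suffices to find one nonzero value ζ v at every vertex such that every vertex v outside some pair
x, y has a vector of L on a triple v, p, q that differs from ζ at v and agrees with it at p and q
(`HasThetaBasis`). Indeed, no nonzero vector of L then takes only the values 0 and ζ, so local
complementations can turn every ζ v into (0,1) (`exists_locallyEquivalent`). In the resulting graph
the vector at v is the row of v, so v has exactly the neighbors p and q. A prime graph in which all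
vertices but two have degree two is a theta graph: follow the edges at x until they reach y
(`exists_iso_thetaGraph`).

To find ζ, uncross separations by submodularity. Every essential vertex lies on a triple, and an
analogue of Tutte's triangle lemma (`exists_adjacent_onTriple`) continues triples to chains of
triples overlapping in two points. With at least seven vertices, the middle of a chain of five
points lies on only three triples (`eq_of_fiveChain`); near the non-essential vertices, of which
there are at most two, there are similar uniqueness statements. Hence each essential vertex can be
made the center of one of its triples such that all its other triples share one value there, which
becomes ζ (`exists_value_of_central`), and distinct vertices are centers of distinct triples
(`central_injective`). So a triple agrees with ζ at its points other than its center. Five and six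
vertices are treated by hand. -/

/-- The plane over the field with two elements. -/
abbrev Plane : Type := ZMod 2 × ZMod 2

/-- The symplectic form of the plane. -/
def area (x y : Plane) : ZMod 2 := x.1 * y.2 + x.2 * y.1

lemma area_eq_zero_iff : ∀ x y : Plane, area x y = 0 ↔ x = 0 ∨ y = 0 ∨ x = y := by decide

lemma area_zero_left (x : Plane) : area 0 x = 0 := by simp [area]

lemma area_zero_right (x : Plane) : area x 0 = 0 := by simp [area]

lemma plane_add_eq_zero_iff : ∀ x y : Plane, x + y = 0 ↔ x = y := by decide

lemma plane_add_add_eq_zero : ∀ x y z : Plane, x ≠ 0 → y ≠ 0 → z ≠ 0 → x ≠ y → x ≠ z → y ≠ z →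
    x + y + z = 0 := by decide

lemma eq_add_of_ne : ∀ x y z : Plane, x ≠ 0 → y ≠ 0 → x ≠ y → z ≠ 0 → z ≠ x → z ≠ y →
    z = x + y := by decide

lemma exists_ne_zero_ne : ∀ x : Plane, ∃ z : Plane, z ≠ 0 ∧ z ≠ x := by decide

/-! ### Lagrangian subspaces and their connectivity function -/

section Code

variable {V : Type*} [Fintype V]

/-- The symplectic form on the vectors with entries in the plane. -/
def symplecticForm (V : Type*) [Fintype V] : LinearMap.BilinForm (ZMod 2) (V → Plane) :=
  LinearMap.mk₂ (ZMod 2) (fun c d => ∑ v, area (c v) (d v))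
    (fun a b c => by
      rw [← sum_add_distrib]; refine sum_congr rfl fun v _ => ?_; simp [area]; ring)
    (fun r a b => by
      rw [smul_eq_mul, mul_sum]; refine sum_congr rfl fun v _ => ?_; simp [area]; ring)
    (fun a b c => by
      rw [← sum_add_distrib]; refine sum_congr rfl fun v _ => ?_; simp [area]; ring)
    (fun r a b => by
      rw [smul_eq_mul, mul_sum]; refine sum_congr rfl fun v _ => ?_; simp [area]; ring)

lemma symplecticForm_apply (c d : V → Plane) :
    symplecticForm V c d = ∑ v, area (c v) (d v) := rfl

lemma symplecticForm_ker : (symplecticForm V).ker = ⊥ := by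
  classical
  refine (Submodule.eq_bot_iff _).2 fun c hc => ?_
  have key : ∀ v (x : Plane), area (c v) x = 0 := by
    intro v x
    have := LinearMap.congr_fun (LinearMap.mem_ker.1 hc) (Pi.single v x)
    rw [symplecticForm_apply, sum_eq_single v] at this
    · simpa using this
    · intro w _ hw
      rw [Pi.single_eq_of_ne hw, area_zero_right]
    · simp
  have aux : ∀ y : Plane, (∀ x, area y x = 0) → y = 0 := by decide
  funext v
  exact aux _ (key v)

/-- The vectors which vanish outside of `A`. -/
def supportedOn (A : Finset V) : Submodule (ZMod 2) (V → Plane) where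
  carrier := {c | ∀ v, v ∉ A → c v = 0}
  zero_mem' := fun _ _ => rfl
  add_mem' := fun {a b} ha hb v hv => by simp [ha v hv, hb v hv]
  smul_mem' := fun r a ha v hv => by simp [ha v hv]

lemma mem_supportedOn {A : Finset V} {c : V → Plane} :
    c ∈ supportedOn A ↔ ∀ v, v ∉ A → c v = 0 := Iff.rfl

lemma two_mul_card_le_finrank_supportedOn (A : Finset V) :
    2 * A.card ≤ finrank (ZMod 2) (supportedOn A) := by
  classical
  let f : (A → Plane) →ₗ[ZMod 2] supportedOn A :=
    { toFun := fun g => ⟨fun v => if h : v ∈ A then g ⟨v, h⟩ else 0, fun v hv => by simp [hv]⟩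
      map_add' := fun g h => by
        ext v : 2
        by_cases hv : v ∈ A <;> simp [hv]
      map_smul' := fun r h => by
        ext v : 2
        by_cases hv : v ∈ A <;> simp [hv] }
  have hf : Function.Injective f := by
    intro g h hgh
    funext v
    have := congrFun (congrArg Subtype.val hgh) v
    simpa [f] using this
  have := LinearMap.finrank_le_finrank_of_injective hf
  have h2 : finrank (ZMod 2) (A → Plane) = 2 * A.card := by
    rw [Module.finrank_pi_fintype]
    simp [mul_comm]
  omega

/-- A Lagrangian subspace: a totally isotropic subspace of dimension `|V|`. -/
structure IsLagrangian (L : Submodule (ZMod 2) (V → Plane)) : Prop where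
  isotropic : ∀ c ∈ L, ∀ d ∈ L, ∑ v, area (c v) (d v) = 0
  finrank_eq : finrank (ZMod 2) L = Fintype.card V

/-- The dimension of the space of vectors of `L` supported on `A`. -/
noncomputable def dimOn (L : Submodule (ZMod 2) (V → Plane)) (A : Finset V) : ℕ :=
  finrank (ZMod 2) (L ⊓ supportedOn A : Submodule (ZMod 2) (V → Plane))

/-- The connectivity function of `L`. -/
noncomputable def conn (L : Submodule (ZMod 2) (V → Plane)) (A : Finset V) : ℤ :=
  A.card - dimOn L A

variable {L : Submodule (ZMod 2) (V → Plane)}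

lemma supportedOn_mono {A B : Finset V} (h : A ⊆ B) : supportedOn A ≤ supportedOn B :=
  fun _ hc v hv => hc v fun hA => hv (h hA)

variable [DecidableEq V]

lemma supportedOn_inter (A B : Finset V) :
    supportedOn (A ∩ B) = supportedOn A ⊓ supportedOn B := by
  ext c
  simp only [Submodule.mem_inf, mem_supportedOn, mem_inter]
  constructor
  · intro h
    exact ⟨fun v hv => h v fun h' => hv h'.1, fun v hv => h v fun h' => hv h'.2⟩
  · rintro ⟨h₁, h₂⟩ v hv
    by_cases h : v ∈ A
    · exact h₂ v fun h' => hv ⟨h, h'⟩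
    · exact h₁ v h

lemma dimOn_add_le (A B : Finset V) :
    dimOn L A + dimOn L B ≤ dimOn L (A ∩ B) + dimOn L (A ∪ B) := by
  have h := Submodule.finrank_sup_add_finrank_inf_eq (L ⊓ supportedOn A) (L ⊓ supportedOn B)
  have h1 : (L ⊓ supportedOn A) ⊓ (L ⊓ supportedOn B) = L ⊓ supportedOn (A ∩ B) := by
    rw [supportedOn_inter, ← inf_inf_distrib_left]
  have h2 : (L ⊓ supportedOn A) ⊔ (L ⊓ supportedOn B) ≤ L ⊓ supportedOn (A ∪ B) :=
    sup_le (inf_le_inf_left _ (supportedOn_mono subset_union_left))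
      (inf_le_inf_left _ (supportedOn_mono subset_union_right))
  have h3 := Submodule.finrank_mono h2
  rw [h1] at h
  unfold dimOn
  omega

/-- Submodularity, the source of all uncrossing: it is the dimension formula for the vectors
supported on A and those supported on B. -/
lemma conn_inter_add_conn_union_le (A B : Finset V) :
    conn L (A ∩ B) + conn L (A ∪ B) ≤ conn L A + conn L B := by
  have h1 := dimOn_add_le (L := L) A B
  have h2 := card_union_add_card_inter A B
  unfold conn
  omega

/-- A vector of L supported off A is orthogonal both to L and to everything supported on A;
nondegeneracy bounds the dimension. Used for A and for its complement, this makes `conn` symmetric.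
-/
lemma dimOn_compl_le (hL : IsLagrangian L) (A : Finset V) :
    dimOn L Aᶜ + A.card ≤ dimOn L A + Aᶜ.card := by
  have h := Submodule.finrank_sup_add_finrank_inf_eq L (supportedOn A)
  have h2 := two_mul_card_le_finrank_supportedOn A
  have h3 := (symplecticForm V).finrank_add_finrank_orthogonal' (L ⊔ supportedOn A)
  have h4 : L ⊓ supportedOn Aᶜ ≤ (symplecticForm V).orthogonal (L ⊔ supportedOn A) := by
    intro c hc
    rw [LinearMap.BilinForm.mem_orthogonal_iff]
    intro d hd
    change symplecticForm V d c = 0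
    obtain ⟨d₁, hd₁, d₂, hd₂, rfl⟩ := Submodule.mem_sup.1 hd
    rw [map_add, LinearMap.add_apply, symplecticForm_apply, symplecticForm_apply,
      hL.isotropic _ hd₁ _ hc.1, zero_add]
    refine sum_eq_zero fun v _ => ?_
    by_cases hv : v ∈ A
    · rw [hc.2 v (by simpa using hv), area_zero_right]
    · rw [hd₂ v hv, area_zero_left]
  have h5 := Submodule.finrank_mono h4
  have h6 : finrank (ZMod 2) (V → Plane) = 2 * Fintype.card V := by
    rw [Module.finrank_pi_fintype]
    simp [mul_comm]
  rw [symplecticForm_ker, inf_bot_eq, finrank_bot] at h3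
  have h7 := hL.finrank_eq
  have h8 := card_add_card_compl A
  unfold dimOn
  omega

lemma conn_compl (hL : IsLagrangian L) (A : Finset V) : conn L Aᶜ = conn L A := by
  have h1 := dimOn_compl_le hL A
  have h2 := dimOn_compl_le hL Aᶜ
  rw [compl_compl] at h2
  unfold conn
  omega

/-- The evaluation at `v` of the vectors of `L` supported on `insert v A`. -/
noncomputable def evalOn (L : Submodule (ZMod 2) (V → Plane)) (A : Finset V) (v : V) :
    (L ⊓ supportedOn (insert v A) : Submodule (ZMod 2) (V → Plane)) →ₗ[ZMod 2] Plane :=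
  (LinearMap.proj v).comp (Submodule.subtype _)

/-- Rank-nullity for evaluation at v, whose kernel consists of the vectors supported on A. The gain
is 0, 1 or 2, according to the values that occur at v. -/
lemma dimOn_insert {A : Finset V} {v : V} (hv : v ∉ A) :
    dimOn L (insert v A) = dimOn L A + finrank (ZMod 2) (LinearMap.range (evalOn L A v)) := by
  have h := (evalOn L A v).finrank_range_add_finrank_ker
  have h2 : finrank (ZMod 2) (LinearMap.ker (evalOn L A v)) = dimOn L A := by
    have h3 : (LinearMap.ker (evalOn L A v)).map (Submodule.subtype _) = L ⊓ supportedOn A := by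
      ext c
      simp only [Submodule.mem_map, LinearMap.mem_ker, Submodule.subtype_apply, Subtype.exists,
        exists_and_right, exists_eq_right]
      constructor
      · rintro ⟨hc, h0⟩
        refine ⟨hc.1, fun w hw => ?_⟩
        by_cases hwv : w = v
        · subst hwv; exact h0
        · exact hc.2 w (by simp [hwv, hw])
      · intro hc
        exact ⟨⟨hc.1, supportedOn_mono (subset_insert _ _) hc.2⟩, hc.2 v hv⟩
    unfold dimOn
    rw [← h3, Submodule.finrank_map_subtype_eq]
  unfold dimOn at *
  omega

lemma mem_range_evalOn {A : Finset V} {v : V} {x : Plane} :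
    x ∈ LinearMap.range (evalOn L A v) ↔ ∃ c ∈ L, c ∈ supportedOn (insert v A) ∧ c v = x := by
  constructor
  · rintro ⟨⟨c, hc⟩, h⟩
    exact ⟨c, hc.1, hc.2, h⟩
  · rintro ⟨c, h1, h2, h3⟩
    exact ⟨⟨c, h1, h2⟩, h3⟩

lemma dimOn_insert_of_mem {A : Finset V} {v : V} (hv : v ∉ A) {c : V → Plane} (hc : c ∈ L)
    (hA : c ∈ supportedOn (insert v A)) (h0 : c v ≠ 0) : dimOn L A + 1 ≤ dimOn L (insert v A) := by
  rw [dimOn_insert hv]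
  have : 0 < finrank (ZMod 2) (LinearMap.range (evalOn L A v)) := by
    rw [Module.finrank_pos_iff_exists_ne_zero]
    exact ⟨⟨c v, mem_range_evalOn.2 ⟨c, hc, hA, rfl⟩⟩, fun h => h0 (congrArg Subtype.val h)⟩
  omega

lemma dimOn_insert_of_mem_of_mem {A : Finset V} {v : V} (hv : v ∉ A) {c d : V → Plane}
    (hc : c ∈ L) (hcA : c ∈ supportedOn (insert v A)) (hc0 : c v ≠ 0)
    (hd : d ∈ L) (hdA : d ∈ supportedOn (insert v A)) (hd0 : d v ≠ 0) (hcd : c v ≠ d v) :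
    dimOn L A + 2 ≤ dimOn L (insert v A) := by
  rw [dimOn_insert hv]
  have h : LinearMap.range (evalOn L A v) = ⊤ := by
    rw [eq_top_iff]
    intro x _
    have hc' : c v ∈ LinearMap.range (evalOn L A v) := mem_range_evalOn.2 ⟨c, hc, hcA, rfl⟩
    have hd' : d v ∈ LinearMap.range (evalOn L A v) := mem_range_evalOn.2 ⟨d, hd, hdA, rfl⟩
    by_cases h0 : x = 0
    · subst h0; exact zero_mem _
    by_cases h1 : x = c v
    · subst h1; exact hc'
    by_cases h2 : x = d v
    · subst h2; exact hd'
    rw [eq_add_of_ne _ _ _ hc0 hd0 hcd h0 h1 h2]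
    exact add_mem hc' hd'
  rw [h, finrank_top]
  simp

lemma exists_of_dimOn_lt {A : Finset V} {v : V} (hv : v ∉ A)
    (h : dimOn L A < dimOn L (insert v A)) :
    ∃ c ∈ L, c ∈ supportedOn (insert v A) ∧ c v ≠ 0 := by
  rw [dimOn_insert hv] at h
  have : 0 < finrank (ZMod 2) (LinearMap.range (evalOn L A v)) := by omega
  rw [Module.finrank_pos_iff_exists_ne_zero] at this
  obtain ⟨⟨x, hx⟩, hx0⟩ := this
  obtain ⟨c, h1, h2, rfl⟩ := mem_range_evalOn.1 hx
  exact ⟨c, h1, h2, fun h => hx0 (Subtype.ext h)⟩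

lemma conn_insert_of_mem {A : Finset V} {v : V} (hv : v ∉ A) {c : V → Plane} (hc : c ∈ L)
    (hA : c ∈ supportedOn (insert v A)) (h0 : c v ≠ 0) : conn L (insert v A) ≤ conn L A := by
  have := dimOn_insert_of_mem hv hc hA h0
  unfold conn
  rw [card_insert_of_notMem hv]
  push_cast
  omega

/-- Two distinct nonzero values span the plane, so the dimension grows by two while the set grows by
one point. This drop provides the extra unit in the uncrossing inequalities. -/
lemma conn_insert_of_mem_of_mem {A : Finset V} {v : V} (hv : v ∉ A) {c d : V → Plane}
    (hc : c ∈ L) (hcA : c ∈ supportedOn (insert v A)) (hc0 : c v ≠ 0)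
    (hd : d ∈ L) (hdA : d ∈ supportedOn (insert v A)) (hd0 : d v ≠ 0) (hcd : c v ≠ d v) :
    conn L (insert v A) + 1 ≤ conn L A := by
  have := dimOn_insert_of_mem_of_mem hv hc hcA hc0 hd hdA hd0 hcd
  unfold conn
  rw [card_insert_of_notMem hv]
  push_cast
  omega

lemma exists_ne_zero_of_dimOn_pos {A : Finset V} (h : 0 < dimOn L A) :
    ∃ c ∈ L, c ∈ supportedOn A ∧ c ≠ 0 := by
  rw [dimOn, Module.finrank_pos_iff_exists_ne_zero] at h
  obtain ⟨⟨c, hc⟩, h0⟩ := h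
  exact ⟨c, hc.1, hc.2, fun h => h0 (Subtype.ext h)⟩

lemma dimOn_pos {A : Finset V} {c : V → Plane} (hc : c ∈ L) (hA : c ∈ supportedOn A)
    (h0 : c ≠ 0) : 0 < dimOn L A := by
  rw [dimOn, Module.finrank_pos_iff_exists_ne_zero]
  exact ⟨⟨c, hc, hA⟩, fun h => h0 (congrArg Subtype.val h)⟩

/-- Two vectors of `L` which do not commute at `p` do not commute at another point. -/
lemma IsLagrangian.exists_ne (hL : IsLagrangian L) {c d : V → Plane} (hc : c ∈ L) (hd : d ∈ L)
    {p : V} (h1 : c p ≠ 0) (h2 : d p ≠ 0) (h3 : c p ≠ d p) :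
    ∃ q, q ≠ p ∧ c q ≠ 0 ∧ d q ≠ 0 ∧ c q ≠ d q := by
  by_contra! hcon
  have h := hL.isotropic c hc d hd
  rw [sum_eq_single p] at h
  · rcases (area_eq_zero_iff _ _).1 h with h | h | h <;> contradiction
  · intro q _ hq
    rw [area_eq_zero_iff]
    by_contra! h'
    exact h'.2.2 (hcon q hq h'.1 h'.2.1)
  · simp

/-! ### Prime codes, triples and separations at a point -/

/-- A Lagrangian subspace all of whose separations have order at least two. -/
structure IsPrimeCode (L : Submodule (ZMod 2) (V → Plane)) : Prop where
  lagrangian : IsLagrangian L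
  five_le_card : 5 ≤ Fintype.card V
  two_le_conn : ∀ A : Finset V, 2 ≤ A.card → 2 ≤ Aᶜ.card → 2 ≤ conn L A

/-- `t` is a vector of `L` whose support consists of the three distinct points `a`, `b`, `c`. -/
structure OnTriple (L : Submodule (ZMod 2) (V → Plane)) (t : V → Plane) (a b c : V) : Prop where
  mem : t ∈ L
  ne₁₂ : a ≠ b
  ne₁₃ : a ≠ c
  ne₂₃ : b ≠ c
  supp : ∀ v, t v ≠ 0 ↔ v = a ∨ v = b ∨ v = c

lemma OnTriple.swap₁₂ {t : V → Plane} {a b c : V} (h : OnTriple L t a b c) :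
    OnTriple L t b a c :=
  ⟨h.mem, h.ne₁₂.symm, h.ne₂₃, h.ne₁₃, fun v => by rw [h.supp]; tauto⟩

lemma OnTriple.swap₂₃ {t : V → Plane} {a b c : V} (h : OnTriple L t a b c) :
    OnTriple L t a c b :=
  ⟨h.mem, h.ne₁₃, h.ne₁₂, h.ne₂₃.symm, fun v => by rw [h.supp]; tauto⟩

lemma OnTriple.swap₁₃ {t : V → Plane} {a b c : V} (h : OnTriple L t a b c) :
    OnTriple L t c b a := h.swap₁₂.swap₂₃.swap₁₂

lemma OnTriple.rotate {t : V → Plane} {a b c : V} (h : OnTriple L t a b c) :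
    OnTriple L t b c a := h.swap₁₂.swap₂₃

lemma OnTriple.apply_ne {t : V → Plane} {a b c : V} (h : OnTriple L t a b c) : t a ≠ 0 :=
  (h.supp a).2 (Or.inl rfl)

lemma OnTriple.apply_ne₂ {t : V → Plane} {a b c : V} (h : OnTriple L t a b c) : t b ≠ 0 :=
  h.swap₁₂.apply_ne

lemma OnTriple.apply_ne₃ {t : V → Plane} {a b c : V} (h : OnTriple L t a b c) : t c ≠ 0 :=
  h.swap₁₃.apply_ne

/-- A separation of order two of the points different from `v` which witnesses that the minor
of `L` at `v` given by the value `x` is not prime. -/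
structure Sep (L : Submodule (ZMod 2) (V → Plane)) (v : V) (x : Plane) (A : Finset V) :
    Prop where
  notMem : v ∉ A
  two_le : 2 ≤ A.card
  two_le_compl : 2 ≤ ((insert v A)ᶜ).card
  conn_le : conn L A ≤ 2
  conn_insert_le : conn L (insert v A) ≤ 2
  exists_mem : ∃ a ∈ L, a ∈ supportedOn (insert v A) ∧ a v = x
  ne_zero : x ≠ 0

/-- At least two of the three minors of `L` at `v` are not prime. -/
def Essential (L : Submodule (ZMod 2) (V → Plane)) (v : V) : Prop :=
  ∃ x y A B, x ≠ y ∧ Sep L v x A ∧ Sep L v y B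

namespace IsPrimeCode

variable (hL : IsPrimeCode L)
include hL

lemma two_le_conn_of_notMem {A : Finset V} (hA : 2 ≤ A.card) {p q : V} (hpq : p ≠ q)
    (hp : p ∉ A) (hq : q ∉ A) : 2 ≤ conn L A := by
  refine hL.two_le_conn A hA ?_
  have : ({p, q} : Finset V) ⊆ Aᶜ := by
    intro v hv
    simp only [mem_insert, mem_singleton] at hv
    rw [mem_compl]
    rcases hv with rfl | rfl <;> assumption
  simpa [card_pair hpq] using card_le_card this

/-- Otherwise some pair of points would carry a nonzero vector, and its connectivity would be at
most 2 - 1. -/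
lemma three_le_card_of_supportedOn {c : V → Plane} (hc : c ∈ L) (h0 : c ≠ 0) {A : Finset V}
    (hA : c ∈ supportedOn A) : 3 ≤ A.card := by
  by_contra! h
  have h5 := hL.five_le_card
  obtain ⟨B, hAB, hB⟩ := exists_superset_card_eq (s := A) (n := 2) (by omega) (by omega)
  have h1 := dimOn_pos hc (supportedOn_mono hAB hA) h0
  have h2 := hL.two_le_conn B (by omega) (by have := card_add_card_compl B; omega)
  unfold conn at h2
  omega

lemma onTriple {c : V → Plane} (hc : c ∈ L) (h0 : c ≠ 0) {p q r : V}
    (h : ∀ v, c v ≠ 0 → v = p ∨ v = q ∨ v = r) : OnTriple L c p q r := by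
  classical
  have key : ∀ A : Finset V, (∀ v, c v ≠ 0 → v ∈ A) → 3 ≤ A.card := fun A hA =>
    hL.three_le_card_of_supportedOn hc h0 fun v hv => by
      by_contra h'
      exact hv (hA v h')
  have h3 := key {p, q, r} (by simpa using h)
  have hpq : p ≠ q := by
    rintro rfl
    have := card_le_two (a := p) (b := r)
    simp at h3; omega
  have hpr : p ≠ r := by
    rintro rfl
    have := card_le_two (a := p) (b := q)
    rw [show ({p, q, p} : Finset V) = {p, q} by ext; simp; tauto] at h3
    omega
  have hqr : q ≠ r := by
    rintro rfl
    have := card_le_two (a := p) (b := q)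
    simp at h3; omega
  refine ⟨hc, hpq, hpr, hqr, fun v => ⟨h v, ?_⟩⟩
  have two : ∀ a b : V, ¬ ∀ v, c v ≠ 0 → v = a ∨ v = b := by
    intro a b hab
    have := key {a, b} (by simpa using hab)
    have := card_le_two (a := a) (b := b)
    omega
  rintro (rfl | rfl | rfl) h'
  · refine two q r fun w hw => ?_
    rcases h w hw with rfl | h | h
    · exact absurd h' hw
    · exact Or.inl h
    · exact Or.inr h
  · refine two p r fun w hw => ?_
    rcases h w hw with h | rfl | h
    · exact Or.inl h
    · exact absurd h' hw
    · exact Or.inr h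
  · refine two p q fun w hw => ?_
    rcases h w hw with h | h | rfl
    · exact Or.inl h
    · exact Or.inr h
    · exact absurd h' hw

/-- Triples are the smallest separations. Consequently two triples with different values at a common
point make that point essential. -/
lemma sep_of_onTriple {t : V → Plane} {a b c : V} (h : OnTriple L t a b c) :
    Sep L a (t a) {b, c} := by
  have h1 : a ∉ ({b, c} : Finset V) := by simp [h.ne₁₂, h.ne₁₃]
  have h2 : ({b, c} : Finset V).card = 2 := card_pair h.ne₂₃
  have h3 : (insert a {b, c} : Finset V).card = 3 := by rw [card_insert_of_notMem h1, h2]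
  have h4 := hL.five_le_card
  have h5 := card_add_card_compl (insert a {b, c} : Finset V)
  have h6 : t ∈ supportedOn (insert a {b, c} : Finset V) := fun v hv => by
    by_contra h'
    exact hv (by simpa using (h.supp v).1 h')
  refine ⟨h1, by omega, by omega, ?_, ?_, ⟨t, h.mem, h6, rfl⟩, h.apply_ne⟩
  · unfold conn; omega
  · have := dimOn_pos h.mem h6 fun h' => h.apply_ne (by rw [h']; rfl)
    unfold conn; omega

/-- Primality forces the other side to have connectivity exactly two, so adjoining v must bring in a
vector that is nonzero at v. This vector meets the given one only at v, so orthogonality forces the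
same value x. -/
lemma sep_compl {v : V} {x : Plane} {A : Finset V} (h : Sep L v x A) :
    Sep L v x (insert v A)ᶜ := by
  have hv := h.notMem
  have e : insert v (insert v A)ᶜ = Aᶜ := by
    ext w
    simp only [mem_insert, mem_compl]
    by_cases hw : w = v
    · subst hw; simpa using hv
    · simp [hw]
  have h1 := conn_compl hL.lagrangian A
  have h2 := conn_compl hL.lagrangian (insert v A)
  have h3 := h.conn_le
  have h4 := h.conn_insert_le
  have h5 := h.two_le
  have h6 := h.two_le_compl
  have hvB : v ∉ (insert v A)ᶜ := by simp
  have h7 := card_insert_of_notMem hv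
  have h8 := card_insert_of_notMem hvB
  have h9 := hL.two_le_conn (insert v A)ᶜ h6 (by rw [compl_compl]; omega)
  obtain ⟨a, haL, haA, rfl⟩ := h.exists_mem
  obtain ⟨b, hbL, hbB, hb0⟩ := exists_of_dimOn_lt (L := L) hvB (by
    rw [e] at h8 ⊢
    unfold conn at *
    omega)
  refine ⟨hvB, h6, ?_, by omega, by rw [e]; omega, ⟨b, hbL, hbB, ?_⟩, h.ne_zero⟩
  · rw [e, compl_compl]; exact h5
  · by_contra hne
    obtain ⟨q, hq, h10, h11, -⟩ := hL.lagrangian.exists_ne hbL haL hb0 h.ne_zero hne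
    have h12 : q ∈ insert v A := by
      by_contra h'; exact h11 (haA q h')
    have h13 : q ∈ insert v (insert v A)ᶜ := by
      by_contra h'; exact h10 (hbB q h')
    simp only [mem_insert, mem_compl, hq, false_or] at h12 h13
    exact h13 h12

omit hL in
lemma sep_exists_mem (hL : IsLagrangian L) {v : V} {x : Plane} {A : Finset V}
    (h : Sep L v x A) {t : V → Plane} (ht : t ∈ L) (h0 : t v ≠ 0) (hx : t v ≠ x) :
    ∃ p ∈ A, t p ≠ 0 := by
  obtain ⟨a, haL, haA, rfl⟩ := h.exists_mem
  obtain ⟨q, hq, h1, h2, -⟩ := hL.exists_ne ht haL h0 h.ne_zero hx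
  refine ⟨q, ?_, h1⟩
  by_contra h'
  exact h2 (haA q (by simp [hq, h']))

omit hL in
-- Submodularity alone gives 4; since both x and y occur at v over A ∪ C, adjoining v lowers the
-- connectivity of the union by one.
lemma conn_add_conn_le_three (hL : IsLagrangian L) {v : V} {x y : Plane} {A C : Finset V}
    (hA : Sep L v x A) (hC : Sep L v y C) (hxy : x ≠ y) :
    conn L (A ∩ C) + conn L ((insert v A)ᶜ ∩ (insert v C)ᶜ) ≤ 3 := by
  obtain ⟨a, haL, haA, rfl⟩ := hA.exists_mem
  obtain ⟨c, hcL, hcC, rfl⟩ := hC.exists_mem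
  have h1 := conn_inter_add_conn_union_le (L := L) A C
  have h2 : v ∉ A ∪ C := by simp [hA.notMem, hC.notMem]
  have h3 := conn_insert_of_mem_of_mem h2 haL
    (supportedOn_mono (insert_subset_insert _ subset_union_left) haA) hA.ne_zero hcL
    (supportedOn_mono (insert_subset_insert _ subset_union_right) hcC) hC.ne_zero hxy
  have h4 := conn_compl hL (insert v (A ∪ C))
  have h5 : (insert v (A ∪ C))ᶜ = (insert v A)ᶜ ∩ (insert v C)ᶜ := by
    ext w; simp; tauto
  rw [h5] at h4
  have := hA.conn_le
  have := hC.conn_le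
  omega

lemma card_inter_le_one {v : V} {x y : Plane} {A C : Finset V}
    (hA : Sep L v x A) (hC : Sep L v y C) (hxy : x ≠ y) :
    (A ∩ C).card ≤ 1 ∨ ((insert v A)ᶜ ∩ (insert v C)ᶜ).card ≤ 1 := by
  by_contra! h
  have h1 := conn_add_conn_le_three hL.lagrangian hA hC hxy
  have h2 : 2 ≤ conn L (A ∩ C) := by
    refine hL.two_le_conn _ h.1 (Nat.le_trans h.2 (card_le_card ?_))
    intro w
    simp
    tauto
  have h3 : 2 ≤ conn L ((insert v A)ᶜ ∩ (insert v C)ᶜ) := by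
    refine hL.two_le_conn _ h.2 (Nat.le_trans h.1 (card_le_card ?_))
    intro w
    simp
    tauto
  omega

lemma sep_exists_onTriple {v : V} {x : Plane} {A : Finset V} (hA : Sep L v x A)
    (h2 : A.card = 2) : ∃ t p q, OnTriple L t v p q ∧ A = {p, q} := by
  obtain ⟨a, haL, haA, rfl⟩ := hA.exists_mem
  obtain ⟨p, q, hpq, rfl⟩ := card_eq_two.1 h2
  refine ⟨a, p, q, hL.onTriple haL (fun h => hA.ne_zero (by rw [h]; rfl)) fun w hw => ?_, rfl⟩
  by_contra h'
  exact hw (haA w (by simpa using h'))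

/-- Cross two separations with different values at v. Of two opposite quadrants one has at most one
point, so one of the four sides is a union of two such quadrants. That side has two points and
yields a triple. -/
lemma exists_onTriple_of_essential {v : V} (hv : Essential L v) :
    ∃ t p q, OnTriple L t v p q := by
  obtain ⟨x, y, A, C, hxy, hA, hC⟩ := hv
  have hB := hL.sep_compl hA
  have hD := hL.sep_compl hC
  have hBB : (insert v (insert v A)ᶜ)ᶜ = A := by
    ext w
    have := hA.notMem
    simp only [mem_compl, mem_insert]
    by_cases hw : w = v
    · subst hw; simpa using this
    · simp [hw]
  have h1 := hL.card_inter_le_one hA hC hxy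
  have h2 := hL.card_inter_le_one hB hC hxy
  rw [hBB] at h2
  have split : ∀ {X C : Finset V}, v ∉ X → X ⊆ (X ∩ C) ∪ (X ∩ (insert v C)ᶜ) := by
    intro X C hX w hw
    by_cases hwC : w ∈ C
    · simp [hw, hwC]
    · have : w ≠ v := fun h => hX (h ▸ hw)
      simp [hw, hwC, this]
  have small : ∀ {X C : Finset V} {z : Plane}, Sep L v z X → (X ∩ C).card ≤ 1 →
      (X ∩ (insert v C)ᶜ).card ≤ 1 → ∃ t p q, OnTriple L t v p q := by
    intro X C z hX h3 h4
    have h5 := card_le_card (split (C := C) hX.notMem)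
    have h6 := card_union_le (X ∩ C) (X ∩ (insert v C)ᶜ)
    have h7 := hX.two_le
    obtain ⟨t, p, q, h, -⟩ := hL.sep_exists_onTriple hX (by omega)
    exact ⟨t, p, q, h⟩
  rcases h1 with h1 | h1 <;> rcases h2 with h2 | h2
  · exact small (C := A) hC (by rwa [inter_comm]) (by rwa [inter_comm])
  · exact small hA h1 h2
  · exact small hB h2 h1
  · exact small (C := A) hD (by rwa [inter_comm]) (by rwa [inter_comm])

omit hL in
lemma exists_sep_ne {v : V} (hv : Essential L v) (x : Plane) :
    ∃ y A, y ≠ x ∧ Sep L v y A := by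
  obtain ⟨y, z, A, C, hyz, hA, hC⟩ := hv
  by_cases h : y = x
  · exact ⟨z, C, fun h' => hyz (h.trans h'.symm), hC⟩
  · exact ⟨y, A, h, hA⟩

/-- A vector on the triple `e`, `f`, `g` separates `f` from `g` in a separation at `e`. -/
lemma exists_sep_mem_notMem {t : V → Plane} {e f g : V} (ht : OnTriple L t e f g)
    (he : Essential L e) : ∃ y A, y ≠ t e ∧ Sep L e y A ∧ f ∈ A ∧ g ∉ A := by
  obtain ⟨y, A, hy, hA⟩ := exists_sep_ne he (t e)
  have key : ∀ {A : Finset V}, Sep L e y A → f ∈ A ∨ g ∈ A := by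
    intro A hA
    obtain ⟨p, hpA, hp⟩ := sep_exists_mem hL.lagrangian hA ht.mem ht.apply_ne hy.symm
    rcases (ht.supp p).1 hp with rfl | rfl | rfl
    · exact absurd hpA hA.notMem
    · exact Or.inl hpA
    · exact Or.inr hpA
  have h1 := key hA
  have h2 := key (hL.sep_compl hA)
  simp only [mem_compl, mem_insert, ht.ne₁₂.symm, ht.ne₁₃.symm, false_or] at h2
  by_cases hf : f ∈ A
  · exact ⟨y, A, hy, hA, hf, by tauto⟩
  · exact ⟨y, _, hy, hL.sep_compl hA, by simp [ht.ne₁₂.symm, hf], by simp; tauto⟩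

end IsPrimeCode

/-! ### The triangle lemma -/

namespace IsPrimeCode

/-- Since f and g lie in A ∪ D, both t and the vector of the separation at e are available over this
union; their values at e differ, so adjoining e lowers its connectivity by one. -/
lemma conn_add_conn_le_of_cross (hL : IsLagrangian L) {t : V → Plane} {e f g : V} {y : Plane}
    {A D : Finset V} (ht : OnTriple L t e f g) (hA : Sep L e y A) (hy : y ≠ t e)
    (hfA : f ∈ A) (hgD : g ∈ D) (heD : e ∉ D) (hD : conn L (insert f D) ≤ 2) :
    conn L (A ∩ insert f D) + conn L (insert e (A ∪ D))ᶜ ≤ 3 := by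
  obtain ⟨a, haL, haA, rfl⟩ := hA.exists_mem
  have h1 := conn_inter_add_conn_union_le (L := L) A (insert f D)
  have e1 : A ∪ insert f D = A ∪ D := by
    ext w; simp only [mem_union, mem_insert]
    by_cases hw : w = f
    · subst hw; simp [hfA]
    · simp [hw]
  rw [e1] at h1
  have h2 : e ∉ A ∪ D := by simp [hA.notMem, heD]
  have h3 := conn_insert_of_mem_of_mem h2 haL
    (supportedOn_mono (insert_subset_insert _ subset_union_left) haA) hA.ne_zero ht.mem
    (fun w hw => by
      by_contra h'
      rcases (ht.supp w).1 h' with rfl | rfl | rfl <;> simp_all) ht.apply_ne hy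
  rw [conn_compl hL]
  have := hA.conn_le
  omega

/-- The analogue of Tutte's triangle lemma. -/
theorem exists_adjacent_onTriple (hL : IsPrimeCode L) {t : V → Plane} {e f g : V}
    (ht : OnTriple L t e f g) (he : Essential L e) (hf : Essential L f) :
    ∃ t' p, (OnTriple L t' e f p ∧ p ≠ g) ∨ (OnTriple L t' e g p ∧ p ≠ f) := by
  obtain ⟨y, A, hy, hA, hfA, hgA⟩ := hL.exists_sep_mem_notMem ht he
  obtain ⟨z, C, hz, hC, heC, hgC⟩ := hL.exists_sep_mem_notMem ht.swap₁₂ hf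
  have hef := ht.ne₁₂
  have heg := ht.ne₁₃
  have hfg := ht.ne₂₃
  have heA := hA.notMem
  have hfC := hC.notMem
  have hB := hL.sep_compl hA
  have hD := hL.sep_compl hC
  set B := (insert e A)ᶜ with hBdef
  set D := (insert f C)ᶜ with hDdef
  have mB : ∀ w, w ∈ B ↔ w ≠ e ∧ w ∉ A := by simp [hBdef]
  have mD : ∀ w, w ∈ D ↔ w ≠ f ∧ w ∉ C := by simp [hDdef]
  have eB : insert e B = Aᶜ := by
    ext w; simp only [mem_insert, mB, mem_compl]; by_cases hw : w = e <;> simp_all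
  have eD : insert f D = Cᶜ := by
    ext w; simp only [mem_insert, mD, mem_compl]; by_cases hw : w = f <;> simp_all
  clear_value B D
  have hgB : g ∈ B := by simp [mB, heg.symm, hgA]
  have hgD : g ∈ D := by simp [mD, hfg.symm, hgC]
  have heD : e ∉ D := by simp [mD, heC]
  have hfB : f ∉ B := by simp [mB, hfA]
  -- the small cases
  by_cases cA : A.card = 2
  · obtain ⟨a, p, q, ha, rfl⟩ := hL.sep_exists_onTriple hA cA
    simp only [mem_insert, mem_singleton, not_or] at hfA hgA
    rcases hfA with rfl | rfl
    · exact ⟨a, q, Or.inl ⟨ha, fun h => hgA.2 h.symm⟩⟩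
    · exact ⟨a, p, Or.inl ⟨ha.swap₂₃, fun h => hgA.1 h.symm⟩⟩
  by_cases cB : B.card = 2
  · obtain ⟨b, p, q, hb, rfl⟩ := hL.sep_exists_onTriple hB cB
    simp only [mem_insert, mem_singleton, not_or] at hgB hfB
    rcases hgB with rfl | rfl
    · exact ⟨b, q, Or.inr ⟨hb, fun h => hfB.2 h.symm⟩⟩
    · exact ⟨b, p, Or.inr ⟨hb.swap₂₃, fun h => hfB.1 h.symm⟩⟩
  by_cases cC : C.card = 2
  · obtain ⟨c, p, q, hc, rfl⟩ := hL.sep_exists_onTriple hC cC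
    simp only [mem_insert, mem_singleton, not_or] at heC hgC
    rcases heC with rfl | rfl
    · exact ⟨c, q, Or.inl ⟨hc.swap₁₂, fun h => hgC.2 h.symm⟩⟩
    · exact ⟨c, p, Or.inl ⟨hc.swap₂₃.swap₁₂, fun h => hgC.1 h.symm⟩⟩
  have cA' := hA.two_le
  have cB' := hB.two_le
  have cC' := hC.two_le
  have cD' := hD.two_le
  -- cardinalities of the quadrants
  have kA : A.card = (A ∩ C).card + (A ∩ D).card + 1 := by
    rw [← card_union_of_disjoint, ← card_insert_of_notMem (a := f)]
    · congr 1; ext w; simp only [mem_insert, mem_union, mem_inter, mD]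
      by_cases hw : w = f <;> simp_all; tauto
    · simp [mD, hfC]
    · rw [Finset.disjoint_left]; simp only [mem_inter, mD]; tauto
  have kB : B.card = (B ∩ C).card + (B ∩ D).card := by
    rw [← card_union_of_disjoint]
    · congr 1; ext w; simp only [mem_union, mem_inter, mD]
      by_cases hw : w = f <;> simp_all; tauto
    · rw [Finset.disjoint_left]; simp only [mem_inter, mD]; tauto
  have kC : C.card = (A ∩ C).card + (B ∩ C).card + 1 := by
    rw [← card_union_of_disjoint, ← card_insert_of_notMem (a := e)]
    · congr 1; ext w; simp only [mem_insert, mem_union, mem_inter, mB]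
      by_cases hw : w = e <;> simp_all; tauto
    · simp [mB, heA]
    · rw [Finset.disjoint_left]; simp only [mem_inter, mB]; tauto
  have kD : D.card = (A ∩ D).card + (B ∩ D).card := by
    rw [← card_union_of_disjoint]
    · congr 1; ext w; simp only [mem_union, mem_inter, mB]
      by_cases hw : w = e <;> simp_all; tauto
    · rw [Finset.disjoint_left]; simp only [mem_inter, mB]; tauto
  -- uncrossing
  have u1 := conn_add_conn_le_of_cross hL.lagrangian ht hA hy hfA hgD heD hD.conn_insert_le
  rw [show (insert e (A ∪ D))ᶜ = B ∩ C by
    ext w; simp only [mem_compl, mem_insert, mem_union, mem_inter, mB, mD]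
    by_cases hw : w = f
    · subst hw; simp [hfA]
    · simp [hw]; tauto] at u1
  have u2 := conn_add_conn_le_of_cross hL.lagrangian ht.swap₁₂ hC hz heC hgB hfB hB.conn_insert_le
  rw [show (insert f (C ∪ B))ᶜ = A ∩ D by
    ext w; simp only [mem_compl, mem_insert, mem_union, mem_inter, mB, mD]
    by_cases hw : w = e
    · subst hw; simp [heC, heA]
    · simp [hw]; tauto] at u2
  have u3 : conn L (B ∩ D) + conn L (A ∩ C) ≤ 3 := by
    obtain ⟨d, hdL, hdD, hdz⟩ := hD.exists_mem
    have h1 := conn_inter_add_conn_union_le (L := L) (insert e B) D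
    have h2 : f ∉ insert e B ∪ D := by simp [hef.symm, hfB, mD]
    have h3 := conn_insert_of_mem_of_mem h2 hdL
      (supportedOn_mono (insert_subset_insert _ subset_union_right) hdD)
      (by rw [hdz]; exact hD.ne_zero) ht.mem
      (fun w hw => by
        by_contra h'
        rcases (ht.supp w).1 h' with rfl | rfl | rfl <;> simp_all) ht.apply_ne₂ (by rwa [hdz])
    have h4 := conn_compl hL.lagrangian (insert f (insert e B ∪ D))
    rw [show (insert f (insert e B ∪ D))ᶜ = A ∩ C by
      ext w; simp only [mem_compl, mem_insert, mem_union, mem_inter, mB, mD]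
      by_cases hw : w = e
      · subst hw; simp [heA]
      · by_cases hw' : w = f
        · subst hw'; simp [hfC]
        · simp [hw, hw']] at h4
    rw [show insert e B ∩ D = B ∩ D by
      ext w; simp only [mem_insert, mem_inter]
      by_cases hw : w = e
      · subst hw; simp [heD]
      · simp [hw]] at h1
    have := hB.conn_insert_le
    have := hD.conn_le
    omega
  have u4 : conn L (insert e (insert f (A ∩ C))) + conn L (B ∩ D) ≤ 4 := by
    have h1 := conn_inter_add_conn_union_le (L := L) (insert e A) (insert f C)
    have h4 := conn_compl hL.lagrangian (insert e A ∪ insert f C)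
    rw [show (insert e A ∪ insert f C)ᶜ = B ∩ D by
      ext w; simp only [mem_compl, mem_insert, mem_union, mem_inter, mB, mD]; tauto] at h4
    rw [show insert e A ∩ insert f C = insert e (insert f (A ∩ C)) by
      ext w; simp only [mem_insert, mem_inter]
      by_cases hw : w = e
      · subst hw; simp [heC]
      · by_cases hw' : w = f
        · subst hw'; simp [hfA]
        · simp [hw, hw']] at h1
    have := hA.conn_insert_le
    have := hC.conn_insert_le
    omega
  -- lower bounds for the connectivity
  have k1 : (A ∩ insert f D).card = (A ∩ D).card + 1 := by
    rw [← card_insert_of_notMem (a := f) (s := A ∩ D) (by simp [mD])]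
    congr 1; ext w; simp only [mem_inter, mem_insert]
    by_cases hw : w = f
    · subst hw; simp [hfA]
    · simp [hw]
  have k2 : (C ∩ insert e B).card = (B ∩ C).card + 1 := by
    rw [← card_insert_of_notMem (a := e) (s := B ∩ C) (by simp [mB])]
    congr 1; ext w; simp only [mem_inter, mem_insert]
    by_cases hw : w = e
    · subst hw; simp [heC]
    · simp [hw]; tauto
  have l1 : 1 ≤ (A ∩ D).card → 2 ≤ conn L (A ∩ insert f D) := fun h =>
    hL.two_le_conn_of_notMem (by omega) heg (by simp [heA]) (by simp [hgA])
  have l2 : 2 ≤ (B ∩ C).card → 2 ≤ conn L (B ∩ C) := fun h =>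
    hL.two_le_conn_of_notMem h hfg (by simp [hfC]) (by simp [hgC])
  have l3 : 1 ≤ (B ∩ C).card → 2 ≤ conn L (C ∩ insert e B) := fun h =>
    hL.two_le_conn_of_notMem (by omega) hfg (by simp [hfC]) (by simp [hgC])
  have l4 : 2 ≤ (A ∩ D).card → 2 ≤ conn L (A ∩ D) := fun h =>
    hL.two_le_conn_of_notMem h heg (by simp [heA]) (by simp [hgA])
  have l5 : 2 ≤ (B ∩ D).card → 2 ≤ conn L (B ∩ D) := fun h =>
    hL.two_le_conn_of_notMem h hef (by simp [heD]) (by simp [hfB])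
  have l6 : 2 ≤ (A ∩ C).card → 2 ≤ conn L (A ∩ C) := fun h =>
    hL.two_le_conn_of_notMem h heg (by simp [heA]) (by simp [hgA])
  have s1 : 1 ≤ (B ∩ D).card := card_pos.2 ⟨g, by simp [hgB, hgD]⟩
  -- Now A, B, C have at least three points and D at least two. If B ∩ D had a single point, B ∩ C
  -- would have at least two, so A ∩ D would be empty by `u1`, leaving D with one point. Hence A ∩ C
  -- has at most one point by `u3`; were it empty, A ∩ D and B ∩ C would both have two points,
  -- contrary to `u1`.
  have p1 : (A ∩ C).card = 1 ∧ 2 ≤ (B ∩ D).card := by omega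
  obtain ⟨p, hp⟩ := card_eq_one.1 p1.1
  have l7 := l5 p1.2
  rw [hp] at u4
  have hpA : p ∈ A ∩ C := by simp [hp]
  rw [mem_inter] at hpA
  have hfp : f ≠ p := by rintro rfl; exact hfC hpA.2
  have hep : e ≠ p := by rintro rfl; exact heA hpA.1
  have hcard : (insert e (insert f {p}) : Finset V).card = 3 := by
    rw [card_insert_of_notMem (by simp [hef, hep]), card_pair hfp]
  -- As B ∩ D has connectivity at least two, `u4` leaves at most two for the three points e, f, p,
  -- so these carry a nonzero vector.
  obtain ⟨c, hcL, hcS, hc0⟩ := exists_ne_zero_of_dimOn_pos (L := L)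
    (A := insert e (insert f {p})) (by unfold conn at u4 l7; omega)
  refine ⟨c, p, Or.inl ⟨hL.onTriple hcL hc0 fun w hw => ?_, ?_⟩⟩
  · by_contra h'
    exact hw (hcS w (by simpa using h'))
  · rintro rfl; exact hgA hpA.1

end IsPrimeCode

/-! ### How triples meet -/

lemma OnTriple.eq_zero {t : V → Plane} {a b c v : V} (h : OnTriple L t a b c) (h1 : v ≠ a)
    (h2 : v ≠ b) (h3 : v ≠ c) : t v = 0 := by
  by_contra h'
  rcases (h.supp v).1 h' with h | h | h <;> contradiction

lemma OnTriple.mem_supportedOn {t : V → Plane} {a b c : V}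
    (h : OnTriple L t a b c) {A : Finset V} (ha : a ∈ A) (hb : b ∈ A) (hc : c ∈ A) :
    t ∈ supportedOn A := fun _ hv =>
  h.eq_zero (fun h => hv (h ▸ ha)) (fun h => hv (h ▸ hb)) (fun h => hv (h ▸ hc))

lemma OnTriple.mem_of_mem {t : V → Plane} {a b c p q r : V} (h : OnTriple L t a b c)
    (h' : OnTriple L t p q r) : p = a ∨ p = b ∨ p = c :=
  (h.supp p).1 h'.apply_ne

/-- `t` is a vector on a triple whose support contains `v`. -/
lemma OnTriple.exists_of_ne_zero {t : V → Plane} {a b c v : V} (h : OnTriple L t a b c)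
    (hv : t v ≠ 0) : ∃ p q, OnTriple L t v p q := by
  rcases (h.supp v).1 hv with rfl | rfl | rfl
  · exact ⟨_, _, h⟩
  · exact ⟨_, _, h.swap₁₂⟩
  · exact ⟨_, _, h.swap₁₃⟩

namespace IsPrimeCode

variable (hL : IsPrimeCode L)
include hL

lemma supportedOn_ext {t t' : V → Plane} (ht : t ∈ L) (ht' : t' ∈ L) {A : Finset V}
    (hA : A.card ≤ 2) (h : ∀ v, v ∉ A → t v = t' v) : t = t' := by
  by_contra hne
  have := hL.three_le_card_of_supportedOn (L.add_mem ht ht') (A := A)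
    (fun h0 => hne (funext fun v => (plane_add_eq_zero_iff _ _).1 (congrFun h0 v)))
    (fun v hv => (plane_add_eq_zero_iff _ _).2 (h v hv))
  omega

/-- Different values at a would give dimension two and hence connectivity at most one on the triple;
with equal values at a, the difference lives on two points and vanishes. -/
lemma eq_of_onTriple {t t' : V → Plane} {a b c : V} (h : OnTriple L t a b c)
    (h' : OnTriple L t' a b c) : t = t' := by
  have hn := hL.five_le_card
  have h1 : a ∉ ({b, c} : Finset V) := by simp [h.ne₁₂, h.ne₁₃]
  have h2 : ({b, c} : Finset V).card = 2 := card_pair h.ne₂₃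
  have h3 : (insert a {b, c} : Finset V).card = 3 := by rw [card_insert_of_notMem h1, h2]
  have h5 := card_add_card_compl (insert a {b, c} : Finset V)
  have h6 : ∀ {t}, OnTriple L t a b c → t ∈ supportedOn (insert a {b, c} : Finset V) :=
    fun {t} h v hv => by
      by_contra h'
      exact hv (by simpa using (h.supp v).1 h')
  have h7 : t a = t' a := by
    by_contra hne
    have h8 := dimOn_insert_of_mem_of_mem h1 h.mem (h6 h) h.apply_ne h'.mem (h6 h') h'.apply_ne hne
    have h9 := hL.two_le_conn (insert a {b, c}) (by omega) (by omega)
    unfold conn at h9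
    omega
  refine hL.supportedOn_ext h.mem h'.mem h2.le fun v hv => ?_
  simp only [mem_insert, mem_singleton, not_or] at hv
  by_cases hva : v = a
  · rw [hva, h7]
  · rw [h.eq_zero hva hv.1 hv.2, h'.eq_zero hva hv.1 hv.2]

/-- Orthogonality: a single point of non-commutation is impossible. Conversely, triples meeting in
only one point agree there. -/
lemma exists_share {t t' : V → Plane} {p a b c d : V} (h : OnTriple L t p a b)
    (h' : OnTriple L t' p c d) (hp : t p ≠ t' p) :
    ∃ q, (q = a ∨ q = b) ∧ (q = c ∨ q = d) ∧ t q ≠ t' q := by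
  obtain ⟨q, hq, h1, h2, h3⟩ := hL.lagrangian.exists_ne h.mem h'.mem h.apply_ne h'.apply_ne hp
  have h4 := (h.supp q).1 h1
  have h5 := (h'.supp q).1 h2
  exact ⟨q, by tauto, by tauto, h3⟩

/-- By orthogonality the vectors disagree at both of a, b or at neither; in the latter case their
sum would be supported on c, d only. -/
lemma apply_ne_of_share {t t' : V → Plane} {a b c d : V} (h : OnTriple L t a b c)
    (h' : OnTriple L t' a b d) (hcd : c ≠ d) : t a ≠ t' a := by
  intro ha
  by_cases hb : t b = t' b
  · have := hL.supportedOn_ext h.mem h'.mem (card_le_two (a := c) (b := d)) fun v hv => by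
      simp only [mem_insert, mem_singleton, not_or] at hv
      by_cases hva : v = a
      · rw [hva, ha]
      by_cases hvb : v = b
      · rw [hvb, hb]
      rw [h.eq_zero hva hvb hv.1, h'.eq_zero hva hvb hv.2]
    exact h.apply_ne₃ (by rw [this, h'.eq_zero h.ne₁₃.symm h.ne₂₃.symm hcd])
  · obtain ⟨q, h1, h2, h3⟩ := hL.exists_share h.swap₁₂ h'.swap₁₂ hb
    rcases h1 with rfl | rfl
    · exact h3 ha
    · rcases h2 with rfl | rfl
      · exact h.ne₁₃ rfl
      · exact hcd rfl

lemma apply_ne_of_share_of_ne {t t' : V → Plane} {a b c d : V} (h : OnTriple L t a b c)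
    (h' : OnTriple L t' a b d) (hne : t ≠ t') : t a ≠ t' a := by
  refine hL.apply_ne_of_share h h' ?_
  rintro rfl
  exact hne (hL.eq_of_onTriple h h')

lemma essential_of_apply_ne {t t' : V → Plane} {p a b c d : V} (h : OnTriple L t p a b)
    (h' : OnTriple L t' p c d) (hp : t p ≠ t' p) : Essential L p :=
  ⟨_, _, _, _, hp, hL.sep_of_onTriple h, hL.sep_of_onTriple h'⟩

lemma essential_of_share {t t' : V → Plane} {a b c d : V} (h : OnTriple L t a b c)
    (h' : OnTriple L t' a b d) (hne : t ≠ t') : Essential L a :=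
  hL.essential_of_apply_ne h h' (hL.apply_ne_of_share_of_ne h h' hne)

/-- Three triples within four points would give dimension three, hence connectivity at most one,
with at least two points outside. -/
lemma not_onTriple_of_share (hn : 6 ≤ Fintype.card V) {t₁ t₂ t : V → Plane} {a b c d : V}
    (h₁ : OnTriple L t₁ a b c) (h₂ : OnTriple L t₂ b c d) (had : a ≠ d)
    (h : OnTriple L t a c d) : False := by
  have hd : d ∉ ({a, b, c} : Finset V) := by simp [had.symm, h₂.ne₁₃.symm, h₂.ne₂₃.symm]
  have h3 : ({a, b, c} : Finset V).card = 3 := by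
    rw [card_insert_of_notMem (by simp [h₁.ne₁₂, h₁.ne₁₃]), card_pair h₁.ne₂₃]
  have h4 := card_insert_of_notMem hd
  have h5 := card_add_card_compl (insert d {a, b, c} : Finset V)
  have h6 := dimOn_pos h₁.mem (h₁.mem_supportedOn (A := {a, b, c}) (by simp) (by simp) (by simp))
    (fun h => h₁.apply_ne (by rw [h]; rfl))
  have h7 := dimOn_insert_of_mem_of_mem hd h₂.mem
    (h₂.mem_supportedOn (by simp) (by simp) (by simp)) h₂.apply_ne₃ h.mem
    (h.mem_supportedOn (by simp) (by simp) (by simp)) h.apply_ne₃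
    (hL.apply_ne_of_share h₂.swap₁₃ h.swap₁₃ h₁.ne₁₂.symm)
  have h8 := hL.two_le_conn (insert d {a, b, c}) (by omega) (by omega)
  unfold conn at h8
  omega

end IsPrimeCode

/-! ### Chains of triples -/

/-- Three vectors on consecutive triples of the sequence `a`, `b`, `c`, `d`, `e`. -/
structure FiveChain (L : Submodule (ZMod 2) (V → Plane)) (t₁ t₂ t₃ : V → Plane)
    (a b c d e : V) : Prop where
  on₁ : OnTriple L t₁ a b c
  on₂ : OnTriple L t₂ b c d
  on₃ : OnTriple L t₃ c d e
  had : a ≠ d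
  hae : a ≠ e
  hbe : b ≠ e

lemma FiveChain.reverse {t₁ t₂ t₃ : V → Plane} {a b c d e : V}
    (h : FiveChain L t₁ t₂ t₃ a b c d e) : FiveChain L t₃ t₂ t₁ e d c b a :=
  ⟨h.on₃.swap₁₃, h.on₂.swap₁₃, h.on₁.swap₁₃, h.hbe.symm, h.hae.symm, h.had.symm⟩

namespace IsPrimeCode

variable (hL : IsPrimeCode L)
include hL

lemma fiveChain_apply_eq {t₁ t₂ t₃ : V → Plane} {a b c d e : V}
    (h : FiveChain L t₁ t₂ t₃ a b c d e) : t₁ c = t₃ c := by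
  by_contra hne
  obtain ⟨q, h1, h2, -⟩ := hL.exists_share h.on₁.rotate.rotate h.on₃ hne
  have := h.had
  have := h.hae
  have := h.hbe
  have := h.on₂.ne₁₃
  rcases h1 with rfl | rfl <;> rcases h2 with h2 | h2 <;> contradiction

lemma fiveChain_apply_ne₁ {t₁ t₂ t₃ : V → Plane} {a b c d e : V}
    (h : FiveChain L t₁ t₂ t₃ a b c d e) : t₁ c ≠ t₂ c :=
  hL.apply_ne_of_share h.on₁.swap₁₃ h.on₂.swap₁₂ h.had

lemma fiveChain_ne {t₁ t₂ t₃ : V → Plane} {a b c d e : V}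
    (h : FiveChain L t₁ t₂ t₃ a b c d e) : t₁ ≠ t₂ ∧ t₁ ≠ t₃ ∧ t₂ ≠ t₃ := by
  refine ⟨fun h' => hL.fiveChain_apply_ne₁ h (by rw [h']), ?_, fun h' =>
    hL.fiveChain_apply_ne₁ h.reverse (by rw [h'])⟩
  rintro rfl
  exact h.on₁.apply_ne (h.on₃.eq_zero h.on₁.ne₁₃ h.had h.hae)

/-- The middle of a chain of five points is contained in only three triples. -/
lemma eq_of_fiveChain (hn : 7 ≤ Fintype.card V) {t₁ t₂ t₃ t : V → Plane} {a b c d e p q : V}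
    (h : FiveChain L t₁ t₂ t₃ a b c d e) (ht : OnTriple L t c p q) :
    t = t₁ ∨ t = t₂ ∨ t = t₃ := by
  by_contra! hcon
  obtain ⟨hc1, hc2, hc3⟩ := hcon
  have o1 := h.on₁
  have o2 := h.on₂
  have o3 := h.on₃
  have n1 := hL.fiveChain_apply_ne₁ h
  have e13 := hL.fiveChain_apply_eq h
  -- If t agreed with t₁ (hence with t₃) at c, it would differ from t₂ there and thus share b or d
  -- as well; but two triples sharing two points differ at both.
  have key : t c ≠ t₁ c := by
    intro h1
    obtain ⟨r, hr, hr', -⟩ := hL.exists_share ht o2.swap₁₂ (by rw [h1]; exact n1)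
    obtain ⟨s, hs⟩ : ∃ s, OnTriple L t c r s := by
      rcases hr with rfl | rfl
      exacts [⟨_, ht⟩, ⟨_, ht.swap₂₃⟩]
    rcases hr' with rfl | rfl
    · exact hL.apply_ne_of_share_of_ne hs o1.swap₁₃ hc1 h1
    · exact hL.apply_ne_of_share_of_ne hs o3 hc3 (h1.trans e13)
  obtain ⟨r, hr, hr', -⟩ := hL.exists_share ht o1.swap₁₃ key
  obtain ⟨s, hs, hs', -⟩ := hL.exists_share ht o3 (by rwa [← e13])
  have hrs : r ≠ s := by
    have := h.had
    have := h.hae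
    have := h.hbe
    have := o2.ne₁₃
    rintro rfl
    rcases hr' with rfl | rfl <;> rcases hs' with h' | h' <;> contradiction
  have hT : OnTriple L t c r s := by
    rcases hr with rfl | rfl <;> rcases hs with rfl | rfl
    · exact absurd rfl hrs
    · exact ht
    · exact ht.swap₂₃
    · exact absurd rfl hrs
  rcases hr' with rfl | rfl <;> rcases hs' with rfl | rfl
  · exact hc2 (hL.eq_of_onTriple hT o2.swap₁₂)
  · exact hL.not_onTriple_of_share (by omega) o2.swap₂₃ o3.swap₁₂ h.hbe hT.swap₁₂
  · exact hL.not_onTriple_of_share (by omega) o1 o2 h.had hT.swap₁₂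
  -- Here t joins the two ends of the chain through its middle. The five points then carry dimension
  -- at least four: one from t₂, one from t₁, two from the values of t₃ and t at s. The connectivity
  -- is at most one, and seven vertices leave two points outside.
  · have hne := hL.apply_ne_of_share hT.swap₁₃.swap₂₃ o3.rotate.rotate h.had
    have hd : ({r, b, c, d} : Finset V).card = 4 := by
      rw [card_insert_of_notMem (by simp [o1.ne₁₂, o1.ne₁₃, h.had]),
        card_insert_of_notMem (by simp [o2.ne₁₂, o2.ne₁₃]), card_pair o2.ne₂₃]
    have hbcd : ({b, c, d} : Finset V).card = 3 := by
      rw [card_insert_of_notMem (by simp [o2.ne₁₂, o2.ne₁₃]), card_pair o2.ne₂₃]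
    have hr : r ∉ ({b, c, d} : Finset V) := by simp [o1.ne₁₂, o1.ne₁₃, h.had]
    have hs : s ∉ ({r, b, c, d} : Finset V) := by
      simp [h.hae.symm, h.hbe.symm, o3.ne₁₃.symm, o3.ne₂₃.symm]
    have h4 := card_insert_of_notMem hs
    have h5 := card_add_card_compl (insert s {r, b, c, d} : Finset V)
    have h6 := dimOn_pos o2.mem (o2.mem_supportedOn (A := {b, c, d}) (by simp) (by simp)
      (by simp)) (fun h => o2.apply_ne (by rw [h]; rfl))
    have h7 := dimOn_insert_of_mem hr o1.mem
      (o1.mem_supportedOn (by simp) (by simp) (by simp)) o1.apply_ne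
    have h8 := dimOn_insert_of_mem_of_mem hs o3.mem
      (o3.mem_supportedOn (by simp) (by simp) (by simp)) o3.apply_ne₃ hT.mem
      (hT.mem_supportedOn (by simp) (by simp) (by simp)) hT.apply_ne₃ hne.symm
    have h9 := hL.two_le_conn (insert s {r, b, c, d}) (by omega) (by omega)
    unfold conn at h9
    omega

/-- The triangle lemma at d and b gives a further triple through d and one of b, c; its third point
is not a, as four points cannot carry three triples. The two alternatives differ by the order of b
and c. -/
lemma exists_extension (hn : 6 ≤ Fintype.card V) {t₁ t₂ : V → Plane} {a b c d : V}
    (h₁ : OnTriple L t₁ a b c) (h₂ : OnTriple L t₂ b c d) (had : a ≠ d) (hd : Essential L d) :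
    ∃ e t₃, (FiveChain L t₁ t₂ t₃ a b c d e ∨ FiveChain L t₁ t₂ t₃ a c b d e) := by
  have hne : t₁ ≠ t₂ := by
    rintro rfl
    exact h₁.apply_ne (h₂.eq_zero h₁.ne₁₂ h₁.ne₁₃ had)
  have hb : Essential L b := hL.essential_of_share h₁.rotate h₂ hne
  obtain ⟨t, p, ⟨h, hp⟩ | ⟨h, hp⟩⟩ := hL.exists_adjacent_onTriple h₂.swap₂₃.swap₁₂ hd hb
  · have hpa : a ≠ p := by
      rintro rfl
      exact hL.not_onTriple_of_share hn h₁.swap₂₃ h₂.swap₁₂ had h.rotate.rotate.swap₂₃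
    exact ⟨p, t, Or.inr ⟨h₁.swap₂₃, h₂.swap₁₂, h.swap₁₂, had, hpa, hp.symm⟩⟩
  · have hpa : a ≠ p := by
      rintro rfl
      exact hL.not_onTriple_of_share hn h₁ h₂ had h.rotate.rotate.swap₂₃
    exact ⟨p, t, Or.inl ⟨h₁, h₂, h.swap₁₂, had, hpa, hp.symm⟩⟩

/-- Extend beyond a. The wrong order of b and c would put a fourth triple at the middle c. -/
lemma exists_fiveChain_of_essential (hn : 7 ≤ Fintype.card V) {t₁ t₂ t₃ : V → Plane}
    {a b c d e : V} (h : FiveChain L t₁ t₂ t₃ a b c d e) (ha : Essential L a) :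
    ∃ z t₀, FiveChain L t₀ t₁ t₂ z a b c d := by
  obtain ⟨z, t₀, h' | h'⟩ := hL.exists_extension (by omega) h.on₂.swap₁₃
    h.on₁.swap₁₃ h.had.symm ha
  · exact ⟨z, t₀, h'.reverse⟩
  · exfalso
    have h3 := h'.on₃
    have ha' := h3.apply_ne₂
    rcases hL.eq_of_fiveChain hn h h3 with rfl | rfl | rfl
    · exact h3.apply_ne₃ (h.on₁.eq_zero h3.ne₂₃.symm h'.hbe.symm h3.ne₁₃.symm)
    · exact ha' (h.on₂.eq_zero h.on₁.ne₁₂ h.on₁.ne₁₃ h.had)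
    · exact ha' (h.on₃.eq_zero h.on₁.ne₁₃ h.had h.hae)

end IsPrimeCode

/-! ### Triples near the non-essential points -/

namespace IsPrimeCode

variable (hL : IsPrimeCode L) (hn : 7 ≤ Fintype.card V)
  (hN : {v | ¬ Essential L v}.ncard ≤ 2)

include hN in
lemma essential_of_not_of_not {x y v : V} (hx : ¬ Essential L x)
    (hy : ¬ Essential L y) (hxy : x ≠ y) (hvx : v ≠ x) (hvy : v ≠ y) : Essential L v := by
  by_contra hv
  have h1 : ({v, x, y} : Finset V).card = 3 := by
    rw [card_insert_of_notMem (by simp [hvx, hvy]), card_pair hxy]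
  have h2 : (({v, x, y} : Finset V) : Set V).ncard ≤ {v | ¬ Essential L v}.ncard := by
    refine Set.ncard_le_ncard ?_ (Set.toFinite _)
    intro w hw
    simp only [coe_insert, coe_singleton, Set.mem_insert_iff, Set.mem_singleton_iff] at hw
    rcases hw with rfl | rfl | rfl <;> assumption
  rw [Set.ncard_coe_finset] at h2
  omega

include hL in
lemma eq_of_not_essential {t t' : V → Plane} {x p a b : V} (hx : ¬ Essential L x)
    (h : OnTriple L t x p a) (h' : OnTriple L t' x p b) : t = t' := by
  by_contra hne
  exact hx (hL.essential_of_share h h' hne)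

include hL hN in
/-- A triple with two non-essential points is the only triple at its third point. -/
lemma eq_of_two_not_essential {t t' : V → Plane} {v x y p q : V} (ht : OnTriple L t v x y)
    (hx : ¬ Essential L x) (hy : ¬ Essential L y) (ht' : OnTriple L t' v p q) : t' = t := by
  by_contra hne
  have hxy := ht.ne₂₃
  have aux : ∀ {p q x y}, OnTriple L t v x y → ¬ Essential L x → OnTriple L t' v p q →
      p ≠ x := by
    rintro p q x y h1 h2 h3 rfl
    exact hne (hL.eq_of_not_essential h2 h3.swap₁₂ h1.swap₁₂)
  have hpx := aux ht hx ht'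
  have hqx := aux ht hx ht'.swap₂₃
  have hpy := aux ht.swap₂₃ hy ht'
  have hqy := aux ht.swap₂₃ hy ht'.swap₂₃
  have hv : t v = t' v := by
    by_contra hv
    obtain ⟨r, rfl | rfl, h2 | h2, -⟩ := hL.exists_share ht ht' hv
    exacts [hpx h2.symm, hqx h2.symm, hpy h2.symm, hqy h2.symm]
  have hp := essential_of_not_of_not hN hx hy hxy hpx hpy
  have hvE := essential_of_not_of_not hN hx hy hxy ht.ne₁₂ ht.ne₁₃
  -- A second triple t' meets t only in v, so they agree there. A triple differing from both at v
  -- would disagree with t at x or y as well and make that point essential. The triangle lemma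
  -- applied to t' supplies such a triple.
  have fin : ∀ {t'' r}, t'' v ≠ t' v → ∀ {s}, OnTriple L t'' v r s → False := by
    intro t'' r h1 s h2
    obtain ⟨w, h3, -, h4⟩ := hL.exists_share ht h2 (by rw [hv]; exact h1.symm)
    have h5 : t w ≠ 0 := by
      rcases h3 with rfl | rfl
      exacts [ht.apply_ne₂, ht.apply_ne₃]
    obtain ⟨z, hz, h6, h7, h8⟩ := hL.lagrangian.exists_ne ht.mem h2.mem ht.apply_ne h2.apply_ne
      (by rw [hv]; exact h1.symm)
    obtain ⟨_, _, k1⟩ := ht.exists_of_ne_zero h6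
    obtain ⟨_, _, k2⟩ := h2.exists_of_ne_zero h7
    have hzE := hL.essential_of_apply_ne k1 k2 h8
    rcases (ht.supp z).1 h6 with rfl | rfl | rfl
    exacts [hz rfl, hx hzE, hy hzE]
  obtain ⟨t'', r, ⟨h, hr⟩ | ⟨h, hr⟩⟩ := hL.exists_adjacent_onTriple ht' hvE hp
  · exact fin (hL.apply_ne_of_share h ht' hr) h
  · exact fin (hL.apply_ne_of_share h ht'.swap₂₃ hr) h

include hL hN in
-- A third triple at v avoids a and d, hence contains c, and a third point w. At v and c the three
-- vectors take the three nonzero values, so their sum lives on w, a, d. This triple has two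
-- non-essential points, so it is the only one at w, contradicting t.
lemma eq_of_fourChain {t₁ t₂ t : V → Plane} {a v c d p q : V} (h₁ : OnTriple L t₁ a v c)
    (h₂ : OnTriple L t₂ v c d) (had : a ≠ d) (ha : ¬ Essential L a) (hd : ¬ Essential L d)
    (ht : OnTriple L t v p q) : t = t₁ ∨ t = t₂ := by
  by_contra! hcon
  obtain ⟨hc1, hc2⟩ := hcon
  have ne12 : t₁ v ≠ t₂ v := hL.apply_ne_of_share h₁.rotate h₂ had
  have noa : ∀ {r}, ¬ OnTriple L t v a r := fun {r} h =>
    hc1 (hL.eq_of_not_essential ha h.swap₁₂ h₁)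
  have nod : ∀ {r}, ¬ OnTriple L t v d r := fun {r} h =>
    hc2 (hL.eq_of_not_essential hd h.swap₁₂ h₂.rotate.rotate)
  have hc : ∃ w, OnTriple L t v c w := by
    have pre : ∀ r, r = p ∨ r = q → ∃ s, OnTriple L t v r s := by
      rintro r (rfl | rfl)
      exacts [⟨_, ht⟩, ⟨_, ht.swap₂₃⟩]
    by_cases h : t v = t₁ v
    · obtain ⟨r, h1, h2, -⟩ := hL.exists_share ht h₂ (by rw [h]; exact ne12)
      obtain ⟨s, hs⟩ := pre r h1
      rcases h2 with rfl | rfl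
      · exact ⟨s, hs⟩
      · exact absurd hs nod
    · obtain ⟨r, h1, h2, -⟩ := hL.exists_share ht h₁.swap₁₂ h
      obtain ⟨s, hs⟩ := pre r h1
      rcases h2 with rfl | rfl
      · exact absurd hs noa
      · exact ⟨s, hs⟩
  obtain ⟨w, hw⟩ := hc
  have hwa : w ≠ a := by rintro rfl; exact noa hw.swap₂₃
  have hwd : w ≠ d := by rintro rfl; exact nod hw.swap₂₃
  have hs : OnTriple L (t₁ + t₂ + t) w a d := by
    refine hL.onTriple (L.add_mem (L.add_mem h₁.mem h₂.mem) hw.mem) ?_ ?_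
    · intro h0
      have := congrFun h0 a
      simp only [Pi.add_apply, h₂.eq_zero h₁.ne₁₂ h₁.ne₁₃ had,
        hw.eq_zero h₁.ne₁₂ h₁.ne₁₃ hwa.symm, add_zero] at this
      exact h₁.apply_ne this
    · intro u hu
      by_contra! hu'
      obtain ⟨huw, hua, hud⟩ := hu'
      by_cases huv : u = v
      · subst huv
        exact hu (plane_add_add_eq_zero _ _ _ h₁.apply_ne₂ h₂.apply_ne hw.apply_ne ne12
          (hL.apply_ne_of_share h₁.rotate hw hwa.symm) (hL.apply_ne_of_share h₂ hw hwd.symm))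
      by_cases huc : u = c
      · subst huc
        exact hu (plane_add_add_eq_zero _ _ _ h₁.apply_ne₃ h₂.apply_ne₂ hw.apply_ne₂
          (hL.apply_ne_of_share h₁.rotate.swap₁₂ h₂.swap₁₂ had)
          (hL.apply_ne_of_share h₁.rotate.swap₁₂ hw.swap₁₂ hwa.symm)
          (hL.apply_ne_of_share h₂.swap₁₂ hw.swap₁₂ hwd.symm))
      apply hu
      simp [h₁.eq_zero hua huv huc, h₂.eq_zero huv huc hud, hw.eq_zero huv huc huw]
  have h3 := hL.eq_of_two_not_essential hN hs ha hd hw.rotate.rotate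
  have h4 := congrFun h3 v
  have h5 := hs.eq_zero hw.ne₁₃ h₁.ne₁₂.symm h₂.ne₁₃
  exact hw.apply_ne (by rw [h3, h5])

include hL hn hN in
-- A third triple would be of the form v, d, w. If e is essential, the chain extends beyond e and d
-- becomes a middle with a fourth triple. Otherwise t₁ + t₃ + t is supported on w, a, e, which has
-- two non-essential points, and uniqueness at w is violated.
lemma eq_of_fiveChain_of_not_essential {t₁ t₂ t₃ t : V → Plane} {a v c d e p q : V}
    (h : FiveChain L t₁ t₂ t₃ a v c d e) (ha : ¬ Essential L a)
    (ht : OnTriple L t v p q) : t = t₁ ∨ t = t₂ := by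
  by_contra! hcon
  obtain ⟨hc1, hc2⟩ := hcon
  have o1 := h.on₁
  have o2 := h.on₂
  have o3 := h.on₃
  have ne12 : t₁ v ≠ t₂ v := hL.apply_ne_of_share o1.rotate o2 h.had
  have pre : ∀ r, r = p ∨ r = q → ∃ s, OnTriple L t v r s := by
    rintro r (rfl | rfl)
    exacts [⟨_, ht⟩, ⟨_, ht.swap₂₃⟩]
  have noa : ∀ {r}, ¬ OnTriple L t v a r := fun {r} h =>
    hc1 (hL.eq_of_not_essential ha h.swap₁₂ o1)
  have noc : ∀ {r}, ¬ OnTriple L t v c r := fun {r} hr => by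
    rcases hL.eq_of_fiveChain hn h hr.swap₁₂ with rfl | rfl | rfl
    · exact hc1 rfl
    · exact hc2 rfl
    · exact hr.apply_ne (o3.eq_zero o2.ne₁₂ o2.ne₁₃ h.hbe)
  have hv : t v = t₁ v := by
    by_contra hv
    obtain ⟨r, h1, h2, -⟩ := hL.exists_share ht o1.swap₁₂ hv
    obtain ⟨s, hs⟩ := pre r h1
    rcases h2 with rfl | rfl
    exacts [noa hs, noc hs]
  obtain ⟨w, hw⟩ : ∃ w, OnTriple L t v d w := by
    obtain ⟨r, h1, h2, -⟩ := hL.exists_share ht o2 (by rw [hv]; exact ne12)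
    obtain ⟨s, hs⟩ := pre r h1
    rcases h2 with rfl | rfl
    exacts [absurd hs noc, ⟨s, hs⟩]
  have hwa : w ≠ a := by rintro rfl; exact noa hw.swap₂₃
  have hwc : w ≠ c := by rintro rfl; exact noc hw.swap₂₃
  by_cases he : Essential L e
  · obtain ⟨z, t₀, h'⟩ := hL.exists_fiveChain_of_essential hn h.reverse he
    rcases hL.eq_of_fiveChain hn h' hw.swap₁₂ with rfl | rfl | rfl
    · exact hw.apply_ne (h'.on₁.eq_zero h'.hae.symm h.hbe o2.ne₁₃)
    · exact hw.apply_ne (o3.eq_zero o2.ne₁₂ o2.ne₁₃ h.hbe)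
    · exact hc2 rfl
  · have hwe : w ≠ e := by
      rintro rfl
      have := hL.eq_of_not_essential he hw.rotate.rotate.swap₂₃ o3.rotate.rotate.swap₂₃
      subst this
      exact hw.apply_ne (o3.eq_zero o2.ne₁₂ o2.ne₁₃ h.hbe)
    have hd : t d = t₃ d := by
      by_contra hd
      obtain ⟨r, h1, h2, -⟩ := hL.exists_share hw.swap₁₂ o3.swap₁₂ hd
      have := h.hbe
      have := o2.ne₁₂
      rcases h1 with rfl | rfl <;> rcases h2 with h2 | h2 <;> contradiction
    have hc := hL.fiveChain_apply_eq h
    have hs : OnTriple L (t₁ + t₃ + t) w a e := by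
      refine hL.onTriple (L.add_mem (L.add_mem o1.mem o3.mem) hw.mem) ?_ ?_
      · intro h0
        have := congrFun h0 a
        simp only [Pi.add_apply, o3.eq_zero o1.ne₁₃ h.had h.hae,
          hw.eq_zero o1.ne₁₂ h.had hwa.symm, add_zero] at this
        exact o1.apply_ne this
      · intro u hu
        by_contra! hu'
        obtain ⟨huw, hua, hue⟩ := hu'
        apply hu
        simp only [Pi.add_apply]
        by_cases huv : u = v
        · subst huv
          rw [hv, o3.eq_zero o2.ne₁₂ o2.ne₁₃ h.hbe, add_zero]
          exact (plane_add_eq_zero_iff _ _).2 rfl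
        by_cases huc : u = c
        · subst huc
          rw [hc, hw.eq_zero o2.ne₁₂.symm o2.ne₂₃ hwc.symm, add_zero]
          exact (plane_add_eq_zero_iff _ _).2 rfl
        by_cases hud : u = d
        · subst hud
          rw [hd, o1.eq_zero h.had.symm o2.ne₁₃.symm o2.ne₂₃.symm, zero_add]
          exact (plane_add_eq_zero_iff _ _).2 rfl
        simp [o1.eq_zero hua huv huc, o3.eq_zero huc hud hue, hw.eq_zero huv hud huw]
    have h3 := hL.eq_of_two_not_essential hN hs ha he hw.rotate.rotate
    have h5 := hs.eq_zero hw.ne₁₃ o1.ne₁₂.symm h.hbe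
    exact hw.apply_ne (by rw [h3, h5])

include hL hn in
-- Prolong chains through v by the triangle lemma until v is in the middle of five points or
-- non-essential ends stop the process.
lemma essential_cases {v : V} (hv : Essential L v) :
    (∃ t x y, OnTriple L t v x y ∧ ¬ Essential L x ∧ ¬ Essential L y) ∨
    (∃ t₁ t₂ a c d, OnTriple L t₁ a v c ∧ OnTriple L t₂ v c d ∧ a ≠ d ∧
      ¬ Essential L a ∧ ¬ Essential L d) ∨
    (∃ t₁ t₂ t₃ a c d e, FiveChain L t₁ t₂ t₃ a v c d e ∧ ¬ Essential L a) ∨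
    (∃ t₁ t₂ t₃ a b d e, FiveChain L t₁ t₂ t₃ a b v d e) := by
  obtain ⟨t, p, q, ht⟩ := hL.exists_onTriple_of_essential hv
  by_cases hpq : ¬ Essential L p ∧ ¬ Essential L q
  · exact Or.inl ⟨t, p, q, ht, hpq⟩
  refine Or.inr ?_
  -- two triples sharing `v` and another point
  obtain ⟨t₁, t₂, a, c, d, h1, h2, had⟩ : ∃ t₁ t₂ a c d, OnTriple L t₁ a v c ∧
      OnTriple L t₂ v c d ∧ a ≠ d := by
    have aux : ∀ {p q}, OnTriple L t v p q → Essential L p → ∃ t₁ t₂ a c d,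
        OnTriple L t₁ a v c ∧ OnTriple L t₂ v c d ∧ a ≠ d := by
      intro p q ht hp
      obtain ⟨t', r, ⟨h, hr⟩ | ⟨h, hr⟩⟩ := hL.exists_adjacent_onTriple ht hv hp
      · exact ⟨t, t', q, p, r, ht.rotate.rotate, h, hr.symm⟩
      · exact ⟨t, t', p, q, r, ht.swap₁₂, h, hr.symm⟩
    by_cases hp : Essential L p
    · exact aux ht hp
    · exact aux ht.swap₂₃ (by tauto)
  have step : ∀ {t₁ t₂ a d}, OnTriple L t₁ a v c → OnTriple L t₂ v c d → a ≠ d →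
      Essential L d → (∃ t₁ t₂ t₃ a c d e, FiveChain L t₁ t₂ t₃ a v c d e ∧ ¬ Essential L a) ∨
      (∃ t₁ t₂ t₃ a b d e, FiveChain L t₁ t₂ t₃ a b v d e) := by
    intro t₁ t₂ a d h1 h2 had hd
    obtain ⟨e, t₃, h | h⟩ := hL.exists_extension (by omega) h1 h2 had hd
    · by_cases ha : Essential L a
      · obtain ⟨z, t₀, h'⟩ := hL.exists_fiveChain_of_essential hn h ha
        exact Or.inr ⟨_, _, _, _, _, _, _, h'⟩
      · exact Or.inl ⟨_, _, _, _, _, _, _, h, ha⟩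
    · exact Or.inr ⟨_, _, _, _, _, _, _, h⟩
  by_cases hd : Essential L d
  · exact Or.inr (step h1 h2 had hd)
  by_cases ha : Essential L a
  · exact Or.inr (step h2.rotate.rotate h1.rotate had.symm ha)
  · exact Or.inl ⟨_, _, _, _, _, h1, h2, had, ha, hd⟩

include hL hn in
-- If a were essential, the triangle lemma would give another triple through a and v or through a
-- and b. But v and b are both middles, whose only three triples are known.
lemma not_essential_of_two_fiveChains {t₁ t₂ t₃ t₃' : V → Plane} {a b v d e e' : V}
    (h : FiveChain L t₁ t₂ t₃ a b v d e) (h' : FiveChain L t₁ t₂ t₃' a v b d e') :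
    ¬ Essential L a := by
  intro ha
  have hv : Essential L v :=
    hL.essential_of_share h.on₁.rotate.rotate.swap₂₃ h.on₂.swap₁₂ (hL.fiveChain_ne h).1
  obtain ⟨t, r, ⟨ht, hr⟩ | ⟨ht, hr⟩⟩ := hL.exists_adjacent_onTriple h'.on₁ ha hv
  · rcases hL.eq_of_fiveChain hn h ht.swap₁₂ with rfl | rfl | rfl
    · exact ht.apply_ne₃ (h.on₁.eq_zero ht.ne₁₃.symm hr ht.ne₂₃.symm)
    · exact ht.apply_ne (h.on₂.eq_zero h.on₁.ne₁₂ h.on₁.ne₁₃ h.had)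
    · exact ht.apply_ne (h.on₃.eq_zero h.on₁.ne₁₃ h.had h.hae)
  · rcases hL.eq_of_fiveChain hn h' ht.swap₁₂ with rfl | rfl | rfl
    · exact ht.apply_ne₃ (h'.on₁.eq_zero ht.ne₁₃.symm hr ht.ne₂₃.symm)
    · exact ht.apply_ne (h.on₂.eq_zero h.on₁.ne₁₂ h.on₁.ne₁₃ h.had)
    · exact ht.apply_ne (h'.on₃.eq_zero h'.on₁.ne₁₃ h'.had h'.hae)

end IsPrimeCode

/-! ### Central triples and the case of at least seven points -/

/-- There are values `ζ v` such that for all points `v` but two, `L` has a vector on a triple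
which differs from `ζ` at `v` and agrees with it at the other two points of the triple. -/
def HasThetaBasis (L : Submodule (ZMod 2) (V → Plane)) : Prop :=
  ∃ (ζ : V → Plane) (x y : V), x ≠ y ∧ (∀ v, ζ v ≠ 0) ∧ ∀ v, v ≠ x → v ≠ y →
    ∃ t p q, OnTriple L t v p q ∧ t v ≠ ζ v ∧ t p = ζ p ∧ t q = ζ q

/-- The triple supporting `t` is chosen as the one with center `v`. -/
inductive Central (L : Submodule (ZMod 2) (V → Plane)) (r : V → ℕ) (v : V) (t : V → Plane) : Prop
  | single (x y : V) (h : OnTriple L t v x y) (hx : ¬ Essential L x) (hy : ¬ Essential L y)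
  | pair (t₂ : V → Plane) (a c d : V) (h₁ : OnTriple L t a v c) (h₂ : OnTriple L t₂ v c d)
    (had : a ≠ d) (ha : ¬ Essential L a) (hd : ¬ Essential L d) (hr : r v < r c ↔ r a < r d)
  | second (t₂ t₃ : V → Plane) (a c d e : V) (h : FiveChain L t t₂ t₃ a v c d e)
    (ha : ¬ Essential L a)
  | middle (t₁ t₃ : V → Plane) (a b d e : V) (h : FiveChain L t₁ t t₃ a b v d e)

lemma Central.exists_onTriple {r : V → ℕ} {v : V} {t : V → Plane} (h : Central L r v t) :
    ∃ p q, OnTriple L t v p q := by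
  rcases h with ⟨x, y, h, -, -⟩ | ⟨t₂, a, c, d, h, -⟩ | ⟨t₂, t₃, a, c, d, e, h, -⟩ |
    ⟨t₁, t₃, a, b, d, e, h⟩
  · exact ⟨_, _, h⟩
  · exact ⟨_, _, h.swap₁₂⟩
  · exact ⟨_, _, h.on₁.swap₁₂⟩
  · exact ⟨_, _, h.on₂.swap₁₂⟩

namespace IsPrimeCode

variable (hL : IsPrimeCode L) (hn : 7 ≤ Fintype.card V)
  (hN : {v | ¬ Essential L v}.ncard ≤ 2)

include hL in
lemma fiveChain_essential_snd {t₁ t₂ t₃ : V → Plane} {a b c d e : V}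
    (h : FiveChain L t₁ t₂ t₃ a b c d e) : Essential L b :=
  hL.essential_of_share h.on₁.rotate h.on₂ (hL.fiveChain_ne h).1

include hL in
lemma fiveChain_essential_mid {t₁ t₂ t₃ : V → Plane} {a b c d e : V}
    (h : FiveChain L t₁ t₂ t₃ a b c d e) : Essential L c :=
  hL.essential_of_share h.on₁.swap₁₃ h.on₂.swap₁₂ (hL.fiveChain_ne h).1

include hL hn in
lemma exists_central (r : V → ℕ) (hr : Function.Injective r) {v : V} (hv : Essential L v) :
    ∃ t, Central L r v t := by
  rcases hL.essential_cases hn hv with ⟨t, x, y, h, hx, hy⟩ |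
    ⟨t₁, t₂, a, c, d, h1, h2, had, ha, hd⟩ | ⟨t₁, t₂, t₃, a, c, d, e, h, ha⟩ |
    ⟨t₁, t₂, t₃, a, b, d, e, h⟩
  · exact ⟨t, .single x y h hx hy⟩
  · have h3 : r v ≠ r c := fun h => h1.ne₂₃ (hr h)
    have h4 : r a ≠ r d := fun h => had (hr h)
    -- Both v and c lie on the same two triples and must receive different ones. Exchanging v and c,
    -- but not the ends, reverses the condition, so the numbering r breaks the tie consistently.
    by_cases h5 : r v < r c ↔ r a < r d
    · exact ⟨t₁, .pair t₂ a c d h1 h2 had ha hd h5⟩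
    · exact ⟨t₂, .pair t₁ d c a h2.rotate.rotate h1.rotate had.symm hd ha (by omega)⟩
  · exact ⟨t₁, .second t₂ t₃ a c d e h ha⟩
  · exact ⟨t₂, .middle t₁ t₃ a b d e h⟩

include hL hn hN in
-- In every case the triples at v are known completely: besides the central one there is none, one,
-- or, at a middle, two that agree at v.
lemma exists_value_of_central {r : V → ℕ} {v : V} {t : V → Plane} (h : Central L r v t) :
    ∃ z, z ≠ 0 ∧ z ≠ t v ∧ ∀ t' p q, OnTriple L t' v p q → t' ≠ t → t' v = z := by
  rcases h with ⟨x, y, h, hx, hy⟩ | ⟨t₂, a, c, d, h1, h2, had, ha, hd, -⟩ |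
    ⟨t₂, t₃, a, c, d, e, h, ha⟩ | ⟨t₁, t₃, a, b, d, e, h⟩
  · obtain ⟨z, hz⟩ := exists_ne_zero_ne (t v)
    exact ⟨z, hz.1, hz.2, fun t' p q h' hne =>
      absurd (hL.eq_of_two_not_essential hN h hx hy h') hne⟩
  · refine ⟨t₂ v, h2.apply_ne, (hL.apply_ne_of_share h1.rotate h2 had).symm,
      fun t' p q h' hne => ?_⟩
    rcases hL.eq_of_fourChain hN h1 h2 had ha hd h' with rfl | rfl
    exacts [absurd rfl hne, rfl]
  · refine ⟨t₂ v, h.on₂.apply_ne, (hL.apply_ne_of_share h.on₁.rotate h.on₂ h.had).symm,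
      fun t' p q h' hne => ?_⟩
    rcases hL.eq_of_fiveChain_of_not_essential hn hN h ha h' with rfl | rfl
    exacts [absurd rfl hne, rfl]
  · refine ⟨t₁ v, h.on₁.apply_ne₃, hL.fiveChain_apply_ne₁ h, fun t' p q h' hne => ?_⟩
    rcases hL.eq_of_fiveChain hn h h' with rfl | rfl | rfl
    exacts [rfl, absurd rfl hne, (hL.fiveChain_apply_eq h).symm]

include hL hn hN in
lemma eq_of_middle_of_middle {t t₁ t₃ t₁' t₃' : V → Plane} {v w a b d e a' b' d' e' : V}
    (h : FiveChain L t₁ t t₃ a b v d e) (h' : FiveChain L t₁' t t₃' a' b' w d' e') : v = w := by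
  by_contra hvw
  have core : ∀ {t₁ t₃ t₁' t₃' : V → Plane} {v a b d e a' e' : V},
      FiveChain L t₁ t t₃ a b v d e → FiveChain L t₁' t t₃' a' v b d e' → False := by
    intro t₁ t₃ t₁' t₃' v a b d e a' e' h h'
    obtain rfl : t₁' = t₁ := by
      rcases hL.eq_of_fiveChain hn h h'.on₁.swap₁₂ with h1 | h1 | h1
      · exact h1
      · exact absurd h1 (hL.fiveChain_ne h').1
      · subst h1
        exact absurd (h.on₃.eq_zero h.on₂.ne₁₂ h.on₂.ne₁₃ h.hbe) h'.on₁.apply_ne₃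
    obtain rfl : a = a' := by
      rcases h.on₁.mem_of_mem h'.on₁ with h1 | h1 | h1
      · exact h1.symm
      · exact absurd h1 h'.on₁.ne₁₃
      · exact absurd h1 h'.on₁.ne₁₂
    have hee : e ≠ e' := by
      rintro rfl
      exact hL.not_onTriple_of_share (by omega) h.on₂ h.on₃ h.hbe h'.on₃
    have k : FiveChain L t₃' t t₃ e' b d v e :=
      ⟨h'.on₃.swap₁₃.swap₂₃, h.on₂.swap₂₃, h.on₃.swap₁₂, h'.hbe.symm, hee.symm, h.hbe⟩
    -- The ends a, e, e' are distinct, and each starts two chains with different middles, so all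
    -- three are non-essential: one too many.
    have k1 := hL.not_essential_of_two_fiveChains hn h h'
    have k2 := hL.not_essential_of_two_fiveChains hn h.reverse k.reverse
    have k3 := hL.not_essential_of_two_fiveChains hn h'.reverse k
    exact k3 (essential_of_not_of_not hN k1 k2 h.hae h'.hae.symm hee.symm)
  have core2 : ∀ {t₁ t₃ : V → Plane} {a b d e : V}, FiveChain L t₁ t t₃ a b v d e → w = b →
      False := by
    rintro t₁ t₃ a b d e h rfl
    rcases h'.on₂.swap₁₂.mem_of_mem h.on₂.swap₁₂ with h1 | h1 | h1
    · exact hvw h1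
    · subst h1
      have : d = d' := by
        rcases h'.on₂.mem_of_mem h.on₂.swap₁₃ with h2 | h2 | h2
        · exact absurd h2.symm h.on₂.ne₂₃
        · exact absurd h2.symm h.on₂.ne₁₃
        · exact h2
      subst this
      exact core h h'
    · subst h1
      have : d = b' := by
        rcases h'.on₂.mem_of_mem h.on₂.swap₁₃ with h2 | h2 | h2
        · exact h2
        · exact absurd h2.symm h.on₂.ne₁₃
        · exact absurd h2.symm h.on₂.ne₂₃
      subst this
      exact core h h'.reverse
  rcases h.on₂.swap₁₂.mem_of_mem h'.on₂.swap₁₂ with h1 | h1 | h1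
  · exact hvw h1.symm
  · exact core2 h h1
  · exact core2 h.reverse h1

include hL hN in
lemma eq_third {t : V → Plane} {a v c a' w c' : V} (h : OnTriple L t a v c)
    (h' : OnTriple L t a' w c') (ha : ¬ Essential L a) (ha' : ¬ Essential L a')
    (hv : Essential L v) (hw : Essential L w) (hc : Essential L c) (hvw : v ≠ w) :
    w = c ∧ a' = a ∧ c' = v := by
  have h1 : w = c := by
    rcases h.mem_of_mem h'.swap₁₂ with rfl | rfl | h1
    exacts [absurd hw ha, absurd rfl hvw, h1]
  have h2 : a' = a := by
    rcases h.mem_of_mem h' with h1 | rfl | rfl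
    exacts [h1, absurd hv ha', absurd hc ha']
  refine ⟨h1, h2, ?_⟩
  rcases h.mem_of_mem h'.swap₁₃ with h3 | h3 | h3
  · exact absurd (h2.trans h3.symm) h'.ne₁₃
  · exact h3
  · exact absurd (h1.trans h3.symm) h'.ne₂₃

include hL hn hN in
-- The essential points of t, the number of triples at them and, for four-point chains, the
-- tie-break recover the center; two middles are excluded by the bound on non-essential points.
lemma central_injective {r : V → ℕ} {v w : V} {t : V → Plane} (hr : Function.Injective r)
    (hv : Essential L v) (hw : Essential L w) (h : Central L r v t) (h' : Central L r w t) :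
    v = w := by
  by_contra hvw
  have single : ∀ {v w x y}, Essential L w → v ≠ w → OnTriple L t v x y → ¬ Essential L x →
      ¬ Essential L y → Central L r w t → False := by
    intro v w x y hw hvw h hx hy h'
    obtain ⟨p, q, h'⟩ := h'.exists_onTriple
    rcases h.mem_of_mem h' with rfl | rfl | rfl
    exacts [hvw rfl, hx hw, hy hw]
  have middle : ∀ {t₁ t₃ a b v d e a' p q}, FiveChain L t₁ t t₃ a b v d e →
      OnTriple L t a' p q → Essential L a' := by
    intro t₁ t₃ a b v d e a' p q h h'
    rcases h.on₂.mem_of_mem h' with rfl | rfl | rfl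
    · exact hL.fiveChain_essential_snd h
    · exact hL.fiveChain_essential_mid h
    · exact hL.fiveChain_essential_snd h.reverse
  -- Sharing t forces v to be the middle of the chain in which w is second, but a middle has three
  -- triples and v has at most two.
  have mixed : ∀ {v w t₂ t₂' t₃' a c a' c' d' e'}, Essential L v → Essential L w → v ≠ w →
      OnTriple L t a v c → ¬ Essential L a → Essential L c →
      (∀ {t' p q}, OnTriple L t' v p q → t' = t ∨ t' = t₂) →
      FiveChain L t t₂' t₃' a' w c' d' e' → ¬ Essential L a' → False := by
    intro v w t₂ t₂' t₃' a c a' c' d' e' hv hw hvw h ha hc hu h' ha'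
    obtain ⟨rfl, rfl, rfl⟩ := hL.eq_third hN h h'.on₁ ha ha' hv hw hc hvw
    have hne := hL.fiveChain_ne h'
    have h1 := hu h'.on₂.swap₁₂
    have h2 := hu h'.on₃
    rcases h1 with h1 | h1
    · exact hne.1 h1.symm
    rcases h2 with h2 | h2
    · exact hne.2.1 h2.symm
    · exact hne.2.2 (h1.trans h2.symm)
  rcases h with ⟨x, y, h, hx, hy⟩ | ⟨t₂, a, c, d, h1, h2, had, ha, hd, hrr⟩ |
    ⟨t₂, t₃, a, c, d, e, h, ha⟩ | ⟨t₁, t₃, a, b, d, e, h⟩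
  · exact single hw hvw h hx hy h'
  · have hc : Essential L c := by
      refine hL.essential_of_share h1.rotate.swap₁₂ h2.swap₁₂ ?_
      rintro rfl
      exact h1.apply_ne (h2.eq_zero h1.ne₁₂ h1.ne₁₃ had)
    have hu := fun {t' p q} => hL.eq_of_fourChain hN h1 h2 had ha hd (t := t') (p := p) (q := q)
    rcases h' with ⟨x, y, h', hx, hy⟩ | ⟨t₂', a', c', d', h1', h2', had', ha', hd', hrr'⟩ |
      ⟨t₂', t₃', a', c', d', e', h', ha'⟩ | ⟨t₁', t₃', a', b', d', e', h'⟩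
    · exact single hv (Ne.symm hvw) h' hx hy (.pair t₂ a c d h1 h2 had ha hd hrr)
    · obtain ⟨rfl, rfl, rfl⟩ := hL.eq_third hN h1 h1' ha ha' hv hw hc hvw
      rcases hu h2'.swap₁₂ with rfl | rfl
      · rcases h1.mem_of_mem h2'.swap₁₃ with rfl | rfl | rfl
        exacts [had' rfl, h2'.ne₂₃ rfl, h2'.ne₁₃ rfl]
      · have : d' = d := by
          rcases h2.mem_of_mem h2'.swap₁₃ with rfl | rfl | rfl
          exacts [absurd rfl h2'.ne₂₃, absurd rfl h2'.ne₁₃, rfl]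
        subst this
        have : r c' ≠ r w := fun h => hvw (hr h)
        omega
    · exact mixed hv hw hvw h1 ha hc hu h' ha'
    · exact ha (middle h' h1)
  · have hc := hL.fiveChain_essential_mid h
    have hu := fun {t' p q} => hL.eq_of_fiveChain_of_not_essential hn hN h ha (t := t') (p := p)
      (q := q)
    rcases h' with ⟨x, y, h', hx, hy⟩ | ⟨t₂', a', c', d', h1', h2', had', ha', hd', hrr'⟩ |
      ⟨t₂', t₃', a', c', d', e', h', ha'⟩ | ⟨t₁', t₃', a', b', d', e', h'⟩
    · exact single hv (Ne.symm hvw) h' hx hy (.second t₂ t₃ a c d e h ha)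
    · have hc' : Essential L c' := by
        refine hL.essential_of_share h1'.rotate.swap₁₂ h2'.swap₁₂ ?_
        rintro rfl
        exact h1'.apply_ne (h2'.eq_zero h1'.ne₁₂ h1'.ne₁₃ had')
      exact mixed hw hv (Ne.symm hvw) h1' ha' hc'
        (hL.eq_of_fourChain hN h1' h2' had' ha' hd') h ha
    · exact mixed hv hw hvw h.on₁ ha hc hu h' ha'
    · exact ha (middle h' h.on₁)
  · rcases h' with ⟨x, y, h', hx, hy⟩ | ⟨t₂', a', c', d', h1', h2', had', ha', hd', hrr'⟩ |
      ⟨t₂', t₃', a', c', d', e', h', ha'⟩ | ⟨t₁', t₃', a', b', d', e', h'⟩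
    · exact hx (middle h h'.swap₁₂)
    · exact ha' (middle h h1')
    · exact ha' (middle h h'.on₁)
    · exact hvw (hL.eq_of_middle_of_middle hn hN h h')

include hL hn hN in
-- At an essential point ζ is the common value of its non-central triples; at a non-essential point
-- all triples agree, since a disagreement would make it essential. By injectivity the central
-- triple of v is non-central at its other points.
lemma hasThetaBasis_of_seven_le : HasThetaBasis L := by
  classical
  obtain ⟨r, hr⟩ : ∃ r : V → ℕ, Function.Injective r :=
    ⟨fun v => (Fintype.equivFin V v : ℕ), fun v w h =>
      (Fintype.equivFin V).injective (Fin.ext h)⟩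
  obtain ⟨x, y, hxy, hsub⟩ : ∃ x y : V, x ≠ y ∧ ∀ v, ¬ Essential L v → v = x ∨ v = y := by
    set N := univ.filter fun v => ¬ Essential L v with hNdef
    have h1 : N.card ≤ 2 := by
      rwa [← Set.ncard_coe_finset, hNdef, coe_filter_univ]
    obtain ⟨M, hM, hM2⟩ := exists_superset_card_eq (s := N) (n := 2) h1 (by omega)
    obtain ⟨x, y, hxy, rfl⟩ := card_eq_two.1 hM2
    exact ⟨x, y, hxy, fun v hv => by simpa using hM (by simpa [hNdef] using hv)⟩
  have H : ∀ v, ∃ (t : V → Plane) (z : Plane), z ≠ 0 ∧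
      (Essential L v → Central L r v t ∧ z ≠ t v ∧
        ∀ t' p q, OnTriple L t' v p q → t' ≠ t → t' v = z) ∧
      (¬ Essential L v → ∀ t' p q, OnTriple L t' v p q → t' v = z) := by
    intro v
    by_cases hv : Essential L v
    · obtain ⟨t, ht⟩ := hL.exists_central hn r hr hv
      obtain ⟨z, hz, h⟩ := hL.exists_value_of_central hn hN ht
      exact ⟨t, z, hz, fun _ => ⟨ht, h⟩, fun h => absurd hv h⟩
    · by_cases h : ∃ t p q, OnTriple L t v p q
      · obtain ⟨t, p, q, h⟩ := h
        refine ⟨0, t v, h.apply_ne, fun h => absurd h hv, fun _ t' p' q' h' => ?_⟩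
        by_contra hne
        exact hv (hL.essential_of_apply_ne h' h hne)
      · obtain ⟨z, hz, -⟩ := exists_ne_zero_ne 0
        exact ⟨0, z, hz, fun h => absurd h hv, fun _ t' p' q' h' => absurd ⟨t', p', q', h'⟩ h⟩
  choose t ζ h0 hE hNE using H
  refine ⟨ζ, x, y, hxy, h0, fun v hvx hvy => ?_⟩
  have hv : Essential L v := by
    by_contra hv
    rcases hsub v hv with h | h <;> contradiction
  obtain ⟨hc, hz, -⟩ := hE v hv
  obtain ⟨p, q, h⟩ := hc.exists_onTriple
  have key : ∀ {p q}, OnTriple L (t v) v p q → t v p = ζ p := by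
    intro p q h
    by_cases hp : Essential L p
    · obtain ⟨hc', -, h'⟩ := hE p hp
      refine h' _ _ _ h.swap₁₂ fun heq => h.ne₁₂ ?_
      rw [← heq] at hc'
      exact hL.central_injective hn hN hr hv hp hc hc'
    · exact hNE p hp _ _ _ h.swap₁₂
  exact ⟨t v, p, q, h, hz.symm, key h, key h.swap₂₃⟩

end IsPrimeCode

/-! ### Five and six points -/

namespace IsPrimeCode

variable (hL : IsPrimeCode L)
include hL

lemma exists_onTriple_of_conn_le {a b c : V} (hab : a ≠ b) (hac : a ≠ c) (hbc : b ≠ c)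
    (h : conn L {a, b, c} ≤ 2) : ∃ t, OnTriple L t a b c := by
  have h3 : ({a, b, c} : Finset V).card = 3 := by
    rw [card_insert_of_notMem (by simp [hab, hac]), card_pair hbc]
  obtain ⟨t, htL, htS, ht0⟩ := exists_ne_zero_of_dimOn_pos (L := L) (A := {a, b, c})
    (by unfold conn at h; omega)
  refine ⟨t, hL.onTriple htL ht0 fun v hv => ?_⟩
  by_contra h'
  exact hv (htS v (by simpa using h'))

/-- The complement of a triple has only two points, so by symmetry of `conn` every three points
carry a vector. Any ordering is then a five-point chain, with centers at the three inner points. -/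
lemma hasThetaBasis_of_card_eq_five (hn : Fintype.card V = 5) : HasThetaBasis L := by
  have tri : ∀ {a b c : V}, a ≠ b → a ≠ c → b ≠ c → ∃ t, OnTriple L t a b c := by
    intro a b c hab hac hbc
    refine hL.exists_onTriple_of_conn_le hab hac hbc ?_
    have h3 : ({a, b, c} : Finset V).card = 3 := by
      rw [card_insert_of_notMem (by simp [hab, hac]), card_pair hbc]
    have h4 := card_add_card_compl ({a, b, c} : Finset V)
    rw [← conn_compl hL.lagrangian]
    unfold conn
    omega
  let f : Fin 5 ≃ V := (Fintype.equivFinOfCardEq hn).symm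
  have fne : ∀ {i j : Fin 5}, i ≠ j → f i ≠ f j := fun h h' => h (f.injective h')
  obtain ⟨t₁, h1⟩ := tri (fne (i := 0) (j := 1) (by decide)) (fne (i := 0) (j := 2) (by decide))
    (fne (by decide))
  obtain ⟨t₂, h2⟩ := tri (fne (i := 1) (j := 2) (by decide)) (fne (i := 1) (j := 3) (by decide))
    (fne (by decide))
  obtain ⟨t₃, h3⟩ := tri (fne (i := 2) (j := 3) (by decide)) (fne (i := 2) (j := 4) (by decide))
    (fne (by decide))
  have h : FiveChain L t₁ t₂ t₃ (f 0) (f 1) (f 2) (f 3) (f 4) :=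
    ⟨h1, h2, h3, fne (by decide), fne (by decide), fne (by decide)⟩
  have e13 := hL.fiveChain_apply_eq h
  have n1 := hL.apply_ne_of_share h1.rotate h2 h.had
  have n2 := hL.fiveChain_apply_ne₁ h
  have n3 := hL.apply_ne_of_share h3.swap₁₂ h2.swap₁₃ h.hbe.symm
  let ζ : Fin 5 → Plane := ![t₁ (f 0), t₂ (f 1), t₁ (f 2), t₂ (f 3), t₃ (f 4)]
  refine ⟨fun v => ζ (f.symm v), f 0, f 4, fne (by decide), fun v => ?_, fun v hv0 hv4 => ?_⟩
  · obtain ⟨i, rfl⟩ := f.surjective v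
    simp only [Equiv.symm_apply_apply]
    fin_cases i
    exacts [h1.apply_ne, h2.apply_ne, h1.apply_ne₃, h2.apply_ne₃, h3.apply_ne₃]
  · obtain ⟨i, rfl⟩ := f.surjective v
    simp only [Equiv.symm_apply_apply]
    fin_cases i
    · exact absurd rfl hv0
    · exact ⟨t₁, f 0, f 2, h1.swap₁₂, n1, by simp [ζ], by simp [ζ]⟩
    · exact ⟨t₂, f 1, f 3, h2.swap₁₂, n2.symm, by simp [ζ], by simp [ζ]⟩
    · exact ⟨t₃, f 2, f 4, h3.swap₁₂, n3, by simpa [ζ] using e13.symm, by simp [ζ]⟩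
    · exact absurd rfl hv4

/-- The vectors t₁, t₂, t₃, t₄ get the centers a, b, e, f; the exceptional points are c and d, where
the triples through them agree because they meet nowhere else. -/
lemma hasThetaBasis_of_two_fourChains {t₁ t₂ t₃ t₄ : V → Plane} {a b c d e f : V}
    (h1 : OnTriple L t₁ a b c) (h2 : OnTriple L t₂ a b d) (h3 : OnTriple L t₃ d e f)
    (h4 : OnTriple L t₄ c e f) (hcd : c ≠ d) (he : e ≠ a ∧ e ≠ b ∧ e ≠ c)
    (hf : f ≠ a ∧ f ≠ b ∧ f ≠ c)
    (all : ∀ v, v = a ∨ v = b ∨ v = c ∨ v = d ∨ v = e ∨ v = f) : HasThetaBasis L := by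
  have c1 : t₄ c = t₁ c := by
    by_contra hne
    obtain ⟨q, h5, h6, -⟩ := hL.exists_share h4 h1.rotate.rotate hne
    rcases h5 with rfl | rfl <;> rcases h6 with h6 | h6
    exacts [he.1 h6, he.2.1 h6, hf.1 h6, hf.2.1 h6]
  have c2 : t₃ d = t₂ d := by
    by_contra hne
    obtain ⟨q, h5, h6, -⟩ := hL.exists_share h3 h2.rotate.rotate hne
    rcases h5 with rfl | rfl <;> rcases h6 with h6 | h6
    exacts [he.1 h6, he.2.1 h6, hf.1 h6, hf.2.1 h6]
  have n1 := hL.apply_ne_of_share h1 h2 hcd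
  have n2 := hL.apply_ne_of_share h1.swap₁₂ h2.swap₁₂ hcd
  have n3 := hL.apply_ne_of_share h3.rotate h4.rotate hcd.symm
  have n4 := hL.apply_ne_of_share h3.rotate.swap₁₂ h4.rotate.swap₁₂ hcd.symm
  have ab := h1.ne₁₂
  have ac := h1.ne₁₃
  have bc := h1.ne₂₃
  have ad := h2.ne₁₃
  have bd := h2.ne₂₃
  have de := h3.ne₁₂
  have df := h3.ne₁₃
  have ef := h3.ne₂₃
  obtain ⟨ea, eb, ec⟩ := he
  obtain ⟨fa, fb, fc⟩ := hf
  set ζ : V → Plane := fun v => if v = a ∨ v = d then t₂ v else if v = b ∨ v = c then t₁ v else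
    if v = e then t₄ v else t₃ v with hζ
  have za : ζ a = t₂ a := by simp [hζ]
  have zb : ζ b = t₁ b := by simp [hζ, ab.symm, bd]
  have zc : ζ c = t₁ c := by simp [hζ, ac.symm, hcd]
  have zd : ζ d = t₂ d := by simp [hζ]
  have ze : ζ e = t₄ e := by simp [hζ, ea, eb, ec, de.symm]
  have zf : ζ f = t₃ f := by simp [hζ, fa, fb, fc, df.symm, ef.symm]
  clear_value ζ
  refine ⟨ζ, c, d, hcd, fun v => ?_, fun v hvc hvd => ?_⟩
  · rcases all v with h | h | h | h | h | h <;> rw [h]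
    · rw [za]; exact h2.apply_ne
    · rw [zb]; exact h1.apply_ne₂
    · rw [zc]; exact h1.apply_ne₃
    · rw [zd]; exact h2.apply_ne₃
    · rw [ze]; exact h4.apply_ne₂
    · rw [zf]; exact h3.apply_ne₃
  · rcases all v with h | h | h | h | h | h
    · rw [h]; exact ⟨t₁, b, c, h1, by rwa [za], zb.symm, zc.symm⟩
    · rw [h]; exact ⟨t₂, a, d, h2.swap₁₂, by rw [zb]; exact n2.symm, za.symm, zd.symm⟩
    · exact absurd h hvc
    · exact absurd h hvd
    · rw [h]; exact ⟨t₃, d, f, h3.swap₁₂, by rwa [ze], by rw [zd, c2], zf.symm⟩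
    · rw [h]; exact ⟨t₄, c, e, h4.rotate.rotate, by rw [zf]; exact n4.symm, by rw [zc, c1], ze.symm⟩

/-- By symmetry of `conn`, the complement of a triple again carries a triple. Hence some triple has
two essential points; the triangle lemma gives a second triple through two of its points, and the
complements of both complete the configuration. -/
lemma hasThetaBasis_of_card_eq_six (hn : Fintype.card V = 6)
    (hN : {v | ¬ Essential L v}.ncard ≤ 2) : HasThetaBasis L := by
  have tri : ∀ {t : V → Plane} {a b c : V}, OnTriple L t a b c →
      ∃ d e f t', OnTriple L t' d e f ∧ ∀ v, v = d ∨ v = e ∨ v = f ↔ v ≠ a ∧ v ≠ b ∧ v ≠ c := by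
    intro t a b c h
    have h3 : ({a, b, c} : Finset V).card = 3 := by
      rw [card_insert_of_notMem (by simp [h.ne₁₂, h.ne₁₃]), card_pair h.ne₂₃]
    have h4 := card_add_card_compl ({a, b, c} : Finset V)
    obtain ⟨d, e, f, hde, hdf, hef, hc⟩ := card_eq_three.1
      (show ({a, b, c} : Finset V)ᶜ.card = 3 by omega)
    obtain ⟨t', h'⟩ := hL.exists_onTriple_of_conn_le hde hdf hef (by
      rw [← hc, conn_compl hL.lagrangian]
      have := dimOn_pos h.mem (h.mem_supportedOn (A := {a, b, c}) (by simp) (by simp) (by simp))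
        fun h0 => h.apply_ne (by rw [h0]; rfl)
      unfold conn; omega)
    refine ⟨d, e, f, t', h', fun v => ?_⟩
    have := congrArg (v ∈ ·) hc
    simp only [mem_compl, mem_insert, mem_singleton, not_or] at this
    rw [← this]
  obtain ⟨t₁, a, b, c, h1, ha, hb⟩ : ∃ t a b c, OnTriple L t a b c ∧ Essential L a ∧
      Essential L b := by
    obtain ⟨v, hv⟩ : ∃ v, Essential L v := by
      by_contra! h
      have : {v | ¬ Essential L v} = Set.univ := Set.eq_univ_of_forall h
      rw [this, Set.ncard_univ, Nat.card_eq_fintype_card] at hN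
      omega
    obtain ⟨t, p, q, ht⟩ := hL.exists_onTriple_of_essential hv
    by_cases hp : Essential L p
    · exact ⟨t, v, p, q, ht, hv, hp⟩
    by_cases hq : Essential L q
    · exact ⟨t, v, q, p, ht.swap₂₃, hv, hq⟩
    obtain ⟨d, e, f, t', h', hiff⟩ := tri ht
    have hd := (hiff d).1 (Or.inl rfl)
    have he := (hiff e).1 (Or.inr (Or.inl rfl))
    exact ⟨t', d, e, f, h', essential_of_not_of_not hN hp hq ht.ne₂₃ hd.2.1 hd.2.2,
      essential_of_not_of_not hN hp hq ht.ne₂₃ he.2.1 he.2.2⟩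
  obtain ⟨t₁, t₂, a, b, c, d, h1, h2, hcd⟩ : ∃ t₁ t₂ a b c d, OnTriple L t₁ a b c ∧
      OnTriple L t₂ a b d ∧ c ≠ d := by
    obtain ⟨t', r, ⟨h, hr⟩ | ⟨h, hr⟩⟩ := hL.exists_adjacent_onTriple h1 ha hb
    · exact ⟨t₁, t', _, _, _, _, h1, h, hr.symm⟩
    · exact ⟨t₁, t', _, _, _, _, h1.swap₂₃, h, hr.symm⟩
  obtain ⟨d', e, f, t₃, h3, hiff⟩ := tri h1
  obtain ⟨e, f, h3, hiff⟩ : ∃ e f, OnTriple L t₃ d e f ∧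
      ∀ v, v = d ∨ v = e ∨ v = f ↔ v ≠ a ∧ v ≠ b ∧ v ≠ c := by
    rcases (hiff d).2 ⟨h2.ne₁₃.symm, h2.ne₂₃.symm, hcd.symm⟩ with rfl | rfl | rfl
    · exact ⟨_, _, h3, hiff⟩
    · exact ⟨_, _, h3.swap₁₂, fun v => by rw [← hiff, or_left_comm]⟩
    · exact ⟨_, _, h3.rotate.rotate, fun v => by rw [← hiff, or_comm, or_assoc]⟩
  have he := (hiff e).1 (Or.inr (Or.inl rfl))
  have hf := (hiff f).1 (Or.inr (Or.inr rfl))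
  obtain ⟨t₄, h4⟩ : ∃ t₄, OnTriple L t₄ c e f := by
    obtain ⟨p, q, s, t₄, h4, hiff'⟩ := tri h2
    have hc' := (hiff' c).2 ⟨h1.ne₁₃.symm, h1.ne₂₃.symm, hcd⟩
    have he' := (hiff' e).2 ⟨he.1, he.2.1, h3.ne₁₂.symm⟩
    have hf' := (hiff' f).2 ⟨hf.1, hf.2.1, h3.ne₁₃.symm⟩
    refine ⟨t₄, h4.mem, he.2.2.symm, hf.2.2.symm, h3.ne₂₃, fun v => ?_⟩
    rw [h4.supp, hiff']
    have := hiff v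
    by_cases hvd : v = d
    · subst hvd
      simp [hcd.symm, h3.ne₁₂, h3.ne₁₃]
    by_cases hvc : v = c
    · subst hvc
      simp [h1.ne₁₃.symm, h1.ne₂₃.symm, hcd]
    simp only [hvd, false_or, hvc, ne_eq, not_false_eq_true, and_true] at this ⊢
    rw [this]
  have all : ∀ v, v = a ∨ v = b ∨ v = c ∨ v = d ∨ v = e ∨ v = f := by
    intro v
    by_cases hv : v ≠ a ∧ v ≠ b ∧ v ≠ c
    · exact Or.inr (Or.inr (Or.inr ((hiff v).2 hv)))
    · clear hiff he hf
      tauto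
  exact hL.hasThetaBasis_of_two_fourChains h1 h2 h3 h4 hcd he hf all

theorem hasThetaBasis (hN : {v | ¬ Essential L v}.ncard ≤ 2) : HasThetaBasis L := by
  have h := hL.five_le_card
  by_cases h5 : Fintype.card V = 5
  · exact hL.hasThetaBasis_of_card_eq_five h5
  by_cases h6 : Fintype.card V = 6
  · exact hL.hasThetaBasis_of_card_eq_six h6 hN
  · exact hL.hasThetaBasis_of_seven_le (by omega) hN

end IsPrimeCode

end Code

/-! ### Transport along automorphisms at single points -/

section Transport

variable {V : Type*} [Fintype V]

/-- `L'` is obtained from `L` by applying the automorphism `σ v` to the values at `v`. -/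
def CodeEquiv (L L' : Submodule (ZMod 2) (V → Plane)) (σ : V → Plane ≃ₗ[ZMod 2] Plane) : Prop :=
  ∀ c, c ∈ L ↔ (fun v => σ v (c v)) ∈ L'

variable {L L' : Submodule (ZMod 2) (V → Plane)} {σ : V → Plane ≃ₗ[ZMod 2] Plane}

lemma CodeEquiv.mem_symm (h : CodeEquiv L L' σ) {c : V → Plane} (hc : c ∈ L') :
    (fun v => (σ v).symm (c v)) ∈ L := by
  rw [h]
  simpa using hc

lemma CodeEquiv.dimOn_eq (h : CodeEquiv L L' σ) (A : Finset V) : dimOn L' A = dimOn L A := by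
  have : L' ⊓ supportedOn A = (L ⊓ supportedOn A).map
      (LinearEquiv.piCongrRight σ : (V → Plane) →ₗ[ZMod 2] (V → Plane)) := by
    ext c
    simp only [Submodule.mem_inf, Submodule.mem_map, mem_supportedOn]
    constructor
    · rintro ⟨hc, hA⟩
      refine ⟨fun v => (σ v).symm (c v), ⟨h.mem_symm hc, fun v hv => ?_⟩, ?_⟩
      · simp only [hA v hv, map_zero]
      · funext v; simp
    · rintro ⟨d, ⟨hd, hA⟩, rfl⟩
      refine ⟨(h d).1 hd, fun v hv => ?_⟩
      simp [hA v hv]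
  rw [dimOn, this, LinearEquiv.finrank_map_eq]
  rfl

lemma CodeEquiv.conn_eq (h : CodeEquiv L L' σ) (A : Finset V) : conn L' A = conn L A := by
  rw [conn, conn, h.dimOn_eq]

lemma CodeEquiv.sep [DecidableEq V] (h : CodeEquiv L L' σ) {v : V} {x : Plane} {A : Finset V}
    (hA : Sep L' v x A) : Sep L v ((σ v).symm x) A := by
  obtain ⟨h1, h2, h3, h4, h5, ⟨a, haL, haA, rfl⟩, h7⟩ := hA
  rw [h.conn_eq] at h4 h5
  refine ⟨h1, h2, h3, h4, h5, ⟨_, h.mem_symm haL, fun w hw => ?_, rfl⟩, ?_⟩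
  · simp only [haA w hw, map_zero]
  · simpa using h7

lemma CodeEquiv.refl (L : Submodule (ZMod 2) (V → Plane)) :
    CodeEquiv L L fun _ => LinearEquiv.refl _ _ := fun _ => Iff.rfl

lemma CodeEquiv.trans {L'' : Submodule (ZMod 2) (V → Plane)} {ρ : V → Plane ≃ₗ[ZMod 2] Plane}
    (h : CodeEquiv L L' σ) (h' : CodeEquiv L' L'' ρ) :
    CodeEquiv L L'' fun v => (σ v).trans (ρ v) := fun c => (h c).trans (h' _)

/-- No nonzero vector of `L` takes only the values `0` and `ζ v`. -/
def Avoids (L : Submodule (ZMod 2) (V → Plane)) (ζ : V → Plane) : Prop :=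
  ∀ c ∈ L, (∀ v, c v = 0 ∨ c v = ζ v) → c = 0

lemma CodeEquiv.avoids (h : CodeEquiv L L' σ) {ζ : V → Plane} (hζ : Avoids L ζ) :
    Avoids L' fun v => σ v (ζ v) := by
  intro c hc hv
  have := hζ _ (h.mem_symm hc) fun v => by
    rcases hv v with h | h
    · left; rw [h, map_zero]
    · right; rw [h, LinearEquiv.symm_apply_apply]
  funext v
  simpa using congrFun this v

end Transport

/-! ### Local complementation is an involution -/

section LocalComplement

variable {V : Type u}

lemma localComplement_adj_self {G : SimpleGraph V} {v w : V} :
    (G.localComplement v).Adj v w ↔ G.Adj v w := by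
  change v ≠ w ∧ Xor (G.Adj v w) (G.Adj v v ∧ G.Adj v w) ↔ _
  have h1 : ¬ G.Adj v v := G.irrefl
  have h2 : G.Adj v w → v ≠ w := fun h => h.ne
  unfold Xor
  tauto

lemma localComplement_localComplement (G : SimpleGraph V) (v : V) :
    (G.localComplement v).localComplement v = G := by
  ext a b
  change a ≠ b ∧ Xor ((G.localComplement v).Adj a b)
    ((G.localComplement v).Adj v a ∧ (G.localComplement v).Adj v b) ↔ _
  rw [localComplement_adj_self, localComplement_adj_self]
  change a ≠ b ∧ Xor (a ≠ b ∧ Xor (G.Adj a b) (G.Adj v a ∧ G.Adj v b))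
    (G.Adj v a ∧ G.Adj v b) ↔ _
  have : G.Adj a b → a ≠ b := fun h => h.ne
  unfold Xor
  tauto

end LocalComplement

/-! ### The code of a graph under local complementation -/

section Graph

variable {V : Type u} [Fintype V]

open Classical in
/-- The entries of the adjacency matrix. -/
noncomputable def adjEntry (G : SimpleGraph V) (v w : V) : ZMod 2 := if G.Adj v w then 1 else 0

lemma adjEntry_comm (G : SimpleGraph V) (v w : V) : adjEntry G v w = adjEntry G w v := by
  by_cases h : G.Adj v w
  · simp [adjEntry, h, h.symm]
  · have h' : ¬ G.Adj w v := fun h' => h h'.symm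
    simp [adjEntry, h, h']

lemma adjEntry_self (G : SimpleGraph V) (v : V) : adjEntry G v v = 0 := by
  simp [adjEntry]

lemma adjEntry_eq_one {G : SimpleGraph V} {v w : V} (h : G.Adj v w) : adjEntry G v w = 1 := by
  simp [adjEntry, h]

lemma adjEntry_eq_one_iff {G : SimpleGraph V} {v w : V} : adjEntry G v w = 1 ↔ G.Adj v w := by
  simp [adjEntry]

lemma adjEntry_eq_zero_iff {G : SimpleGraph V} {v w : V} :
    adjEntry G v w = 0 ↔ ¬ G.Adj v w := by
  simp [adjEntry]

/-- The vector `(s, M s)`, where `M` is the adjacency matrix of `G`. -/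
noncomputable def graphVec (G : SimpleGraph V) :
    (V → ZMod 2) →ₗ[ZMod 2] (V → Plane) where
  toFun s v := (s v, ∑ w, adjEntry G v w * s w)
  map_add' s t := by
    funext v
    simp [mul_add, sum_add_distrib]
  map_smul' r s := by
    funext v
    simp [mul_sum, mul_left_comm]

/-- The Lagrangian subspace of a graph. -/
noncomputable def graphCode (G : SimpleGraph V) : Submodule (ZMod 2) (V → Plane) :=
  LinearMap.range (graphVec G)

lemma graphVec_mem (G : SimpleGraph V) (s : V → ZMod 2) : graphVec G s ∈ graphCode G :=
  ⟨s, rfl⟩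

lemma mem_graphCode {G : SimpleGraph V} {c : V → Plane} :
    c ∈ graphCode G ↔ ∀ v, (c v).2 = ∑ w, adjEntry G v w * (c w).1 := by
  constructor
  · rintro ⟨s, rfl⟩ v
    rfl
  · intro h
    refine ⟨fun v => (c v).1, ?_⟩
    funext v
    exact Prod.ext rfl (h v).symm

lemma graphVec_injective (G : SimpleGraph V) : Function.Injective (graphVec G) := by
  intro s t h
  funext v
  exact congrArg Prod.fst (congrFun h v)

lemma isLagrangian_graphCode (G : SimpleGraph V) : IsLagrangian (graphCode G) := by
  constructor
  · intro c hc d hd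
    rw [mem_graphCode] at hc hd
    simp only [area, hc, hd, sum_add_distrib, mul_sum, sum_mul]
    rw [sum_comm, ← sum_add_distrib]
    refine sum_eq_zero fun v _ => ?_
    rw [← sum_add_distrib]
    refine sum_eq_zero fun w _ => ?_
    rw [adjEntry_comm G w v]
    have : ∀ x : ZMod 2, x + x = 0 := by decide
    rw [← this (adjEntry G v w * (c w).1 * (d v).1)]
    ring
  · rw [graphCode, LinearMap.finrank_range_of_inj (graphVec_injective G)]
    simp

/-- The automorphisms which transform `graphCode G` to `graphCode (G.localComplement v)`. -/
noncomputable def complementEquiv [DecidableEq V] (G : SimpleGraph V) (v w : V) :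
    Plane ≃ₗ[ZMod 2] Plane :=
  LinearEquiv.ofInvolutive
    { toFun := fun x => (x.1 + (if w = v then x.2 else 0), x.2 + adjEntry G v w * x.1)
      map_add' := fun x y => by
        ext
        · by_cases h : w = v <;> simp [h]; ring
        · simp; ring
      map_smul' := fun r x => by
        ext
        · by_cases h : w = v <;> simp [h]; ring
        · simp; ring }
    (by
      have h2 : ∀ x y : ZMod 2, x + y + y = x := by decide
      intro x
      by_cases h : w = v
      · subst h
        ext <;> simp [adjEntry_self, h2]
      · ext <;> simp [h, h2])

lemma complementEquiv_apply [DecidableEq V] (G : SimpleGraph V) (v w : V) (x : Plane) :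
    complementEquiv G v w x = (x.1 + (if w = v then x.2 else 0), x.2 + adjEntry G v w * x.1) :=
  rfl

lemma complementEquiv_symm [DecidableEq V] (G : SimpleGraph V) (v w : V) (x : Plane) :
    (complementEquiv G v w).symm x = complementEquiv G v w x := rfl

lemma adjEntry_localComplement [DecidableEq V] (G : SimpleGraph V) (v a b : V) :
    adjEntry (G.localComplement v) a b =
      adjEntry G a b + if a = b then 0 else adjEntry G v a * adjEntry G v b := by
  have h : (G.localComplement v).Adj a b ↔
    a ≠ b ∧ Xor (G.Adj a b) (G.Adj v a ∧ G.Adj v b) := Iff.rfl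
  by_cases hab : a = b
  · subst hab
    simp [adjEntry_self]
  have h11 : (1 : ZMod 2) + 1 = 0 := by decide
  unfold adjEntry
  rw [h]
  by_cases h1 : G.Adj a b <;> by_cases h2 : G.Adj v a <;> by_cases h3 : G.Adj v b <;>
    simp [hab, h1, h2, h3, Xor, h11]

lemma complementEquiv_mem [DecidableEq V] (G : SimpleGraph V) (v : V) {c : V → Plane}
    (hc : c ∈ graphCode G) :
    (fun w => complementEquiv G v w (c w)) ∈ graphCode (G.localComplement v) := by
  rw [mem_graphCode] at hc ⊢
  intro a
  simp only [complementEquiv_apply]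
  have idem : ∀ x y : ZMod 2, x * (x * y) = x * y := by decide
  have cancel : ∀ x y z : ZMod 2, x + y * z + (y * z + y * x) = x + y * x := by decide
  have key : ∀ b, adjEntry (G.localComplement v) a b * ((c b).1 + if b = v then (c b).2 else 0) =
      adjEntry G a b * (c b).1 + (if b = v then adjEntry G a b * (c b).2 else 0) +
      (adjEntry G v a * (adjEntry G v b * (c b).1) +
      (if b = a then adjEntry G v a * (adjEntry G v b * (c b).1) else 0)) := by
    intro b
    rw [adjEntry_localComplement]
    have h2 : ∀ x : ZMod 2, x + x = 0 := by decide
    by_cases hba : b = a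
    · subst hba
      by_cases hbv : b = v
      · subst hbv; simp [adjEntry_self]
      · simp [hbv, h2]
    · by_cases hbv : b = v
      · subst hbv; simp [adjEntry_self, hba, Ne.symm hba]; ring
      · simp [hba, Ne.symm hba, hbv]; ring
  simp only [key, sum_add_distrib, sum_ite_eq', mem_univ, if_true, ← mul_sum, ← hc]
  rw [idem, adjEntry_comm G a v]
  have fin : ∀ x y z w : ZMod 2, x + y * z = x + y * w + (y * w + y * z) := by decide
  exact fin _ _ _ _

lemma codeEquiv_localComplement [DecidableEq V] (G : SimpleGraph V) (v : V) :
    CodeEquiv (graphCode G) (graphCode (G.localComplement v)) (complementEquiv G v) := by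
  intro c
  refine ⟨complementEquiv_mem G v, fun h => ?_⟩
  have h' := complementEquiv_mem _ v h
  rw [localComplement_localComplement] at h'
  convert h' using 1
  funext w
  have : complementEquiv (G.localComplement v) v w = complementEquiv G v w := by
    ext x : 1
    simp only [complementEquiv_apply]
    have : adjEntry (G.localComplement v) v w = adjEntry G v w := by
      rw [adjEntry_localComplement]; simp [adjEntry_self]
    rw [this]
  rw [this]
  exact ((complementEquiv G v w).symm_apply_apply (c w)).symm

/-- Local complementations change the graph so that the values `ζ` become vertical. -/
lemma exists_locallyEquivalent [DecidableEq V] (G : SimpleGraph V) (ζ : V → Plane)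
    (h0 : ∀ v, ζ v ≠ 0) (hζ : Avoids (graphCode G) ζ) :
    ∃ (H : SimpleGraph V) (σ : V → Plane ≃ₗ[ZMod 2] Plane), G.LocallyEquivalent H ∧
      CodeEquiv (graphCode G) (graphCode H) σ ∧ ∀ v, σ v (ζ v) = (0, 1) := by
  obtain ⟨n, hn⟩ : ∃ n, (univ.filter fun v => ζ v ≠ (0, 1)).card = n := ⟨_, rfl⟩
  induction n using Nat.strong_induction_on generalizing G ζ with
  | _ n ih =>
  have next : ∀ (G : SimpleGraph V) (ζ : V → Plane) (v : V), (∃ (H : SimpleGraph V)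
      (σ : V → Plane ≃ₗ[ZMod 2] Plane), (G.localComplement v).LocallyEquivalent H ∧
      CodeEquiv (graphCode (G.localComplement v)) (graphCode H) σ ∧
      ∀ w, σ w (complementEquiv G v w (ζ w)) = (0, 1)) →
      ∃ (H : SimpleGraph V) (σ : V → Plane ≃ₗ[ZMod 2] Plane), G.LocallyEquivalent H ∧
      CodeEquiv (graphCode G) (graphCode H) σ ∧ ∀ v, σ v (ζ v) = (0, 1) := by
    rintro G ζ v ⟨H, σ, h1, h2, h3⟩
    exact ⟨H, _, Relation.ReflTransGen.head ⟨v, rfl⟩ h1,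
      (codeEquiv_localComplement G v).trans h2, h3⟩
  have vert : ∀ (G : SimpleGraph V) (ζ : V → Plane) (v w : V), w ≠ v →
      (complementEquiv G v w (ζ w) = (0, 1) ↔ ζ w = (0, 1)) := by
    intro G ζ v w hw
    rw [complementEquiv_apply]
    have : ∀ (x : Plane) (y : ZMod 2), ((x.1 + 0, x.2 + y * x.1) : Plane) = (0, 1) ↔
      x = (0, 1) := by decide
    rw [if_neg hw]
    exact this _ _
  -- Local complementation at v maps (1,1) at v to (0,1) and fixes (0,1) at every other vertex, so
  -- the number of non-vertical values drops.
  have diag : ∀ (G : SimpleGraph V) (ζ : V → Plane) (v : V), ζ v = (1, 1) →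
      (∀ v, ζ v ≠ 0) → Avoids (graphCode G) ζ →
      (univ.filter fun v => ζ v ≠ (0, 1)).card = n →
      ∃ (H : SimpleGraph V) (σ : V → Plane ≃ₗ[ZMod 2] Plane), G.LocallyEquivalent H ∧
      CodeEquiv (graphCode G) (graphCode H) σ ∧ ∀ v, σ v (ζ v) = (0, 1) := by
    intro G ζ v hv h0 hζ hn
    refine next G ζ v (ih _ ?_ _ (fun w => complementEquiv G v w (ζ w)) (fun w => ?_)
      ((codeEquiv_localComplement G v).avoids hζ) rfl)
    · rw [← hn]
      refine card_lt_card ⟨fun w hw => ?_, fun hsub => ?_⟩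
      · simp only [mem_filter, mem_univ, true_and] at hw ⊢
        intro h
        by_cases hwv : w = v
        · rw [hwv, hv] at h
          exact absurd h (by decide)
        · exact hw ((vert G ζ v w hwv).2 h)
      · have h1 : v ∈ univ.filter fun v => ζ v ≠ (0, 1) := by
          simp [hv]
        have h2 := hsub h1
        simp only [mem_filter, mem_univ, true_and] at h2
        apply h2
        rw [complementEquiv_apply, hv, adjEntry_self]
        simp
        decide
    · simpa using h0 w
  by_cases hall : ∀ v, ζ v = (0, 1)
  · exact ⟨G, _, Relation.ReflTransGen.refl, CodeEquiv.refl _, hall⟩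
  by_cases hdiag : ∃ v, ζ v = (1, 1)
  · obtain ⟨v, hv⟩ := hdiag
    exact diag G ζ v hv h0 hζ hn
  push Not at hall hdiag
  obtain ⟨v, hv⟩ := hall
  have horiz : ∀ {w}, ζ w ≠ (0, 1) → ζ w = (1, 0) := by
    have aux : ∀ x : Plane, x ≠ 0 → x ≠ (1, 1) → x ≠ (0, 1) → x = (1, 0) := by decide
    exact fun {w} h => aux _ (h0 w) (hdiag w) h
  have hv' := horiz hv
  -- Otherwise ζ is (0,1) at all neighbors of v, and the row of v is a nonzero vector with values in
  -- 0 and ζ only.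
  obtain ⟨w, hvw, hw⟩ : ∃ w, G.Adj v w ∧ ζ w = (1, 0) := by
    by_contra! hcon
    have h1 := hζ (graphVec G (Pi.single v 1)) (graphVec_mem _ _) fun w => by
      have e : graphVec G (Pi.single v 1) w = ((Pi.single v 1 : V → ZMod 2) w,
        adjEntry G w v) := by
        simp [graphVec, Pi.single_apply]
      rw [e]
      by_cases hwv : w = v
      · right
        rw [hwv, hv', adjEntry_self, Pi.single_eq_same]
      rw [Pi.single_eq_of_ne hwv]
      by_cases hadj : G.Adj v w
      · right
        rw [adjEntry_eq_one hadj.symm]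
        by_contra h
        exact hcon w hadj (horiz (Ne.symm h))
      · left
        rw [adjEntry_comm, adjEntry_eq_zero_iff.2 hadj]
        rfl
    have h2 := congrArg Prod.fst (congrFun h1 v)
    simp [graphVec] at h2
  have hwv : w ≠ v := hvw.ne'
  -- Local complementation at v keeps (1,0) at v and turns (1,0) at w into (1,1). The count is
  -- unchanged, and `diag` at w lowers it.
  refine next G ζ v (diag _ (fun u => complementEquiv G v u (ζ u)) w ?_ (fun u => ?_)
    ((codeEquiv_localComplement G v).avoids hζ) ?_)
  · rw [complementEquiv_apply, hw, if_neg hwv, adjEntry_eq_one hvw]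
    decide
  · simpa using h0 u
  · rw [← hn]
    congr 1
    ext u
    simp only [mem_filter, mem_univ, true_and]
    by_cases huv : u = v
    · rw [huv, complementEquiv_apply, hv', adjEntry_self]
      simp
    · exact not_iff_not.2 (vert G ζ v u huv)

end Graph

/-! ### Splits under local complementation -/

section Split

variable {V : Type u}

lemma isSplit_compl {G : SimpleGraph V} {A : Set V} (h : G.IsSplit A) : G.IsSplit Aᶜ := by
  obtain ⟨h1, h2, A', hA', B', hB', h⟩ := h
  refine ⟨h2, by rwa [compl_compl], B', hB', A', by rwa [compl_compl], fun x hx y hy => ?_⟩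
  rw [compl_compl] at hy
  rw [G.adj_comm, h y hy x hx, and_comm]

/-- For v in A, the neighbors of v across the cut are B' or none, so toggling changes A' by the
neighborhood of v and leaves B' alone. The other side is symmetric. -/
lemma isSplit_localComplement {G : SimpleGraph V} {A : Set V} (h : G.IsSplit A) (v : V) :
    (G.localComplement v).IsSplit A := by
  have key : ∀ {A : Set V}, G.IsSplit A → v ∈ A → (G.localComplement v).IsSplit A := by
    rintro A ⟨h1, h2, A', hA', B', hB', h⟩ hv
    refine ⟨h1, h2, {x | x ∈ A ∧ Xor (x ∈ A') (G.Adj v x ∧ v ∈ A')}, fun x hx => hx.1, B', hB',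
      fun x hx y hy => ?_⟩
    have hxy : x ≠ y := fun h => hy (h ▸ hx)
    change x ≠ y ∧ Xor (G.Adj x y) (G.Adj v x ∧ G.Adj v y) ↔
      (x ∈ A ∧ Xor (x ∈ A') (G.Adj v x ∧ v ∈ A')) ∧ y ∈ B'
    rw [h x hx y hy, h v hv y hy]
    unfold Xor
    tauto
  by_cases hv : v ∈ A
  · exact key h hv
  · have := isSplit_compl (key (isSplit_compl h) hv)
    rwa [compl_compl] at this

lemma isSplitPrime_localComplement {G : SimpleGraph V} (h : G.IsSplitPrime) (v : V) :
    (G.localComplement v).IsSplitPrime := fun A hA =>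
  h A (localComplement_localComplement G v ▸ isSplit_localComplement hA v)

lemma isSplitPrime_of_locallyEquivalent {G H : SimpleGraph V} (h : G.IsSplitPrime)
    (hGH : G.LocallyEquivalent H) : H.IsSplitPrime := by
  induction hGH with
  | refl => exact h
  | tail _ h' ih =>
    obtain ⟨v, rfl⟩ := h'
    exact isSplitPrime_localComplement ih v

lemma two_le_encard_iff {A : Set V} : 2 ≤ A.encard ↔ ∃ a ∈ A, ∃ b ∈ A, a ≠ b := by
  rw [← one_add_one_eq_two, Order.add_one_le_iff_of_not_isMax (by simp [isMax_iff_eq_top]),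
    Set.one_lt_encard_iff]
  constructor
  · rintro ⟨a, b, ha, hb, hab⟩; exact ⟨a, ha, b, hb, hab⟩
  · rintro ⟨a, ha, b, hb, hab⟩; exact ⟨a, b, ha, hb, hab⟩

end Split

/-! ### From prime graphs to prime codes, and back to degrees -/

section Prime

variable {V : Type u} [Fintype V] [DecidableEq V]

lemma sum_adjEntry_single (G : SimpleGraph V) (a b : V) :
    ∑ w, adjEntry G b w * (Pi.single a 1 : V → ZMod 2) w = adjEntry G b a := by
  simp [Pi.single_apply]

/-- If the cut-rank of `A` is at most one, then the rows of the cut matrix are linearly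
dependent. -/
lemma rows_dependent {G : SimpleGraph V} {A : Finset V} (h : A.card ≤ dimOn (graphCode G) A + 1)
    {a a' : V} (ha : a ∈ A) (ha' : a' ∈ A) (hne : a ≠ a') :
    (∀ b, b ∉ A → ¬ G.Adj b a) ∨ (∀ b, b ∉ A → ¬ G.Adj b a') ∨
      (∀ b, b ∉ A → (G.Adj b a ↔ G.Adj b a')) := by
  by_contra hcon
  let S : Finset V := A.filter fun w => w ≠ a ∧ w ≠ a'
  have hS : A.card = S.card + 2 := by
    rw [← card_filter_add_card_filter_not (s := A) (fun w => w ≠ a ∧ w ≠ a')]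
    congr 1
    rw [← card_pair hne]
    congr 1
    ext w
    simp only [mem_filter, mem_insert, mem_singleton]
    constructor
    · tauto
    · rintro (rfl | rfl) <;> simp [ha, ha']
  let f : (graphCode G ⊓ supportedOn A : Submodule (ZMod 2) (V → Plane)) →ₗ[ZMod 2]
      (S → ZMod 2) :=
    { toFun := fun c w => (c.1 w).1
      map_add' := fun _ _ => rfl
      map_smul' := fun _ _ => rfl }
  -- If the rows of a and a' are independent, a code vector supported on A is determined by its
  -- first coordinates off a and a', so the dimension is at most |A| - 2.
  have hf : Function.Injective f := by
    rw [← LinearMap.ker_eq_bot, Submodule.eq_bot_iff]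
    rintro ⟨c, hcG, hcA⟩ hc
    have h0 : ∀ w, w ≠ a → w ≠ a' → (c w).1 = 0 := by
      intro w h1 h2
      by_cases hw : w ∈ A
      · exact congrFun (LinearMap.mem_ker.1 hc) ⟨w, by simp [S, hw, h1, h2]⟩
      · rw [hcA w hw]; rfl
    have hsum : ∀ b, (c b).2 = adjEntry G b a * (c a).1 + adjEntry G b a' * (c a').1 := by
      intro b
      rw [mem_graphCode.1 hcG b]
      refine Fintype.sum_eq_add a a' hne fun w hw => ?_
      rw [h0 w hw.1 hw.2, mul_zero]
    have hB : ∀ b, b ∉ A → adjEntry G b a * (c a).1 + adjEntry G b a' * (c a').1 = 0 := by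
      intro b hb
      rw [← hsum, hcA b hb]; rfl
    have two : ∀ x : ZMod 2, x = 0 ∨ x = 1 := by decide
    have hfst : (c a).1 = 0 ∧ (c a').1 = 0 := by
      rcases two (c a).1 with h1 | h1 <;> rcases two (c a').1 with h2 | h2
      · exact ⟨h1, h2⟩
      · refine absurd (Or.inr (Or.inl fun b hb => ?_)) hcon
        have := hB b hb
        rw [h1, h2, mul_zero, zero_add, mul_one, adjEntry_eq_zero_iff] at this
        exact this
      · refine absurd (Or.inl fun b hb => ?_) hcon
        have := hB b hb
        rw [h1, h2, mul_zero, add_zero, mul_one, adjEntry_eq_zero_iff] at this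
        exact this
      · refine absurd (Or.inr (Or.inr fun b hb => ?_)) hcon
        have := hB b hb
        rw [h1, h2, mul_one, mul_one] at this
        have aux : ∀ x y : ZMod 2, x + y = 0 → x = y := by decide
        rw [← adjEntry_eq_one_iff, ← adjEntry_eq_one_iff, aux _ _ this]
    refine Subtype.ext (funext fun b => Prod.ext ?_ ?_)
    · by_cases h1 : b = a
      · rw [h1]; exact hfst.1
      by_cases h2 : b = a'
      · rw [h2]; exact hfst.2
      exact h0 b h1 h2
    · change (c b).2 = 0
      rw [hsum, hfst.1, hfst.2]
      simp
  have := LinearMap.finrank_le_finrank_of_injective hf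
  have h2 : finrank (ZMod 2) (S → ZMod 2) = S.card := by simp
  unfold dimOn at h
  omega

/-- Cut-rank at most one means that all nonzero rows of the cut matrix coincide: A' collects the
vertices with nonzero row and B' is the support of that row. -/
lemma two_le_conn_of_isSplitPrime {G : SimpleGraph V} (hG : G.IsSplitPrime) (A : Finset V)
    (h1 : 2 ≤ A.card) (h2 : 2 ≤ Aᶜ.card) : 2 ≤ conn (graphCode G) A := by
  by_contra h
  have hd : A.card ≤ dimOn (graphCode G) A + 1 := by
    unfold conn at h
    omega
  have e : ∀ {B : Finset V}, 2 ≤ B.card → 2 ≤ (B : Set V).encard := by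
    intro B hB
    rw [Set.encard_coe_eq_coe_finsetCard]
    exact_mod_cast hB
  refine hG A ⟨e h1, by rw [← coe_compl]; exact e h2, ?_⟩
  by_cases hrow : ∃ a ∈ A, ∃ b, b ∉ A ∧ G.Adj b a
  · obtain ⟨a, ha, b₀, hb₀, hab₀⟩ := hrow
    refine ⟨{x | x ∈ A ∧ ∃ b, b ∉ A ∧ G.Adj b x}, fun x hx => hx.1,
      {y | y ∉ A ∧ G.Adj y a}, fun y hy => by simpa using hy.1, fun x hx y hy => ?_⟩
    have hxA : x ∈ A := by simpa using hx
    have hyA : y ∉ A := by simpa using hy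
    simp only [Set.mem_ofPred_eq, hxA, hyA, true_and, not_false_eq_true]
    by_cases hxa : x = a
    · subst hxa
      rw [G.adj_comm]
      exact ⟨fun h => ⟨⟨y, hyA, h⟩, h⟩, fun h => h.2⟩
    rcases rows_dependent hd hxA ha hxa with h3 | h3 | h3
    · constructor
      · intro h; exact absurd h.symm (h3 y hyA)
      · rintro ⟨⟨b, hb, h⟩, -⟩; exact absurd h (h3 b hb)
    · exact absurd hab₀ (h3 b₀ hb₀)
    · rw [G.adj_comm, h3 y hyA]
      refine ⟨fun h => ⟨⟨y, hyA, (h3 y hyA).2 h⟩, h⟩, fun h => h.2⟩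
  · push Not at hrow
    refine ⟨∅, by simp, ∅, by simp, fun x hx y hy => ?_⟩
    have := hrow x (by simpa using hx) y (by simpa using hy)
    simp only [Set.mem_empty_iff_false, false_and, iff_false]
    exact fun h => this h.symm

lemma isPrimeCode_graphCode {G : SimpleGraph V} (hG : G.IsSplitPrime)
    (hcard : 5 ≤ Fintype.card V) : IsPrimeCode (graphCode G) :=
  ⟨isLagrangian_graphCode G, hcard, two_le_conn_of_isSplitPrime hG⟩

/-- If the cut between `A` and the remaining vertices different from `v` has rank at most one,
then the cut between `A` and its complement has rank at most two. -/
lemma card_le_dimOn_add_two {G : SimpleGraph V} {v : V} {A : Finset V} {A' B' : Set V}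
    (h : ∀ x ∈ A, ∀ y, y ∉ A → y ≠ v → (G.Adj x y ↔ x ∈ A' ∧ y ∈ B')) :
    A.card ≤ dimOn (graphCode G) A + 2 := by
  classical
  let ext : (A → ZMod 2) →ₗ[ZMod 2] (V → ZMod 2) :=
    { toFun := fun s w => if h : w ∈ A then s ⟨w, h⟩ else 0
      map_add' := fun s t => by
        funext w
        by_cases hw : w ∈ A <;> simp [hw]
      map_smul' := fun r s => by
        funext w
        by_cases hw : w ∈ A <;> simp [hw] }
  have ext_out : ∀ s w, w ∉ A → ext s w = 0 := fun s w hw => by simp [ext, hw]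
  have ext_inj : Function.Injective ext := by
    intro s t hst
    funext w
    have := congrFun hst w
    simpa [ext] using this
  -- Outside A, every row restricted to A is that of v, the indicator of A', or zero. Two linear
  -- conditions therefore suffice for the code vector to vanish outside A.
  let φ : (A → ZMod 2) →ₗ[ZMod 2] ZMod 2 × ZMod 2 :=
    LinearMap.prod ((Fintype.linearCombination (ZMod 2) (adjEntry G v)).comp ext)
      ((Fintype.linearCombination (ZMod 2) (Set.indicator A' (1 : V → ZMod 2))).comp ext)
  have hφ := φ.finrank_range_add_finrank_ker
  have hr : finrank (ZMod 2) (LinearMap.range φ) ≤ 2 := by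
    refine (Submodule.finrank_le _).trans ?_
    simp
  have hA2 : finrank (ZMod 2) (A → ZMod 2) = A.card := by simp
  have hle : ((LinearMap.ker φ).map ext).map (graphVec G) ≤ graphCode G ⊓ supportedOn A := by
    rintro _ ⟨_, ⟨s, hs, rfl⟩, rfl⟩
    refine ⟨graphVec_mem _ _, fun y hy => ?_⟩
    have hs1 : ∑ w, ext s w • adjEntry G v w = 0 :=
      congrArg Prod.fst (LinearMap.mem_ker.1 hs)
    have hs2 : ∑ w, ext s w • Set.indicator A' (1 : V → ZMod 2) w = 0 :=
      congrArg Prod.snd (LinearMap.mem_ker.1 hs)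
    simp only [smul_eq_mul] at hs1 hs2
    refine Prod.ext (ext_out s y hy) ?_
    change ∑ w, adjEntry G y w * ext s w = 0
    by_cases hyv : y = v
    · rw [hyv, ← hs1]
      exact sum_congr rfl fun w _ => mul_comm _ _
    by_cases hyB : y ∈ B'
    · rw [← hs2]
      refine sum_congr rfl fun w _ => ?_
      by_cases hw : w ∈ A
      · have := h w hw y hy hyv
        by_cases hwA : w ∈ A'
        · rw [Set.indicator_of_mem hwA, adjEntry_eq_one (this.2 ⟨hwA, hyB⟩).symm, mul_comm]
          rfl
        · rw [Set.indicator_of_notMem hwA,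
            adjEntry_eq_zero_iff.2 fun h' => hwA (this.1 h'.symm).1, mul_comm]
      · rw [ext_out s w hw, mul_zero, zero_mul]
    · refine sum_eq_zero fun w _ => ?_
      by_cases hw : w ∈ A
      · rw [adjEntry_eq_zero_iff.2 fun h' => hyB ((h w hw y hy hyv).1 h'.symm).2, zero_mul]
      · rw [ext_out s w hw, mul_zero]
  have h3 := Submodule.finrank_mono hle
  rw [(Submodule.equivMapOfInjective _ (graphVec_injective G) _).finrank_eq.symm,
    (Submodule.equivMapOfInjective _ ext_inj _).finrank_eq.symm] at h3
  unfold dimOn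
  omega

lemma exists_sep_of_not_isSplitPrime {G : SimpleGraph V} (hG : G.IsSplitPrime) {v : V}
    (h : ¬ (G.deleteVertex v).IsSplitPrime) : ∃ A, Sep (graphCode G) v (0, 1) A := by
  classical
  unfold IsSplitPrime at h
  push Not at h
  obtain ⟨S, hS1, hS2, S', hS', T', hT', hST⟩ := h
  rw [two_le_encard_iff] at hS1 hS2
  obtain ⟨a₁, ha₁, a₂, ha₂, ha⟩ := hS1
  obtain ⟨b₁, hb₁, b₂, hb₂, hb⟩ := hS2
  set A : Finset V := univ.filter fun w => ∃ h : w ∈ ({v}ᶜ : Set V), (⟨w, h⟩ : ({v}ᶜ : Set V)) ∈ S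
    with hAdef
  have memA : ∀ w : ({v}ᶜ : Set V), (w : V) ∈ A ↔ w ∈ S := by
    rintro ⟨w, hw⟩
    simp only [hAdef, mem_filter, mem_univ, true_and]
    exact ⟨fun ⟨_, h⟩ => h, fun h => ⟨hw, h⟩⟩
  have hvA : v ∉ A := by simp [hAdef]
  clear_value A
  let A' : Set V := Subtype.val '' S'
  let B' : Set V := Subtype.val '' T'
  have hA'A : ∀ x ∈ A', x ∈ A := by
    rintro _ ⟨x, hx, rfl⟩
    exact (memA x).2 (hS' hx)
  have hB'A : ∀ x ∈ B', x ∉ A ∧ x ≠ v := by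
    rintro _ ⟨x, hx, rfl⟩
    exact ⟨fun h => hT' hx ((memA x).1 h), x.2⟩
  have hadj : ∀ x ∈ A, ∀ y, y ∉ A → y ≠ v → (G.Adj x y ↔ x ∈ A' ∧ y ∈ B') := by
    intro x hx y hy hyv
    have hxv : x ≠ v := fun h => hvA (h ▸ hx)
    have := hST ⟨x, hxv⟩ ((memA ⟨x, hxv⟩).1 hx) ⟨y, hyv⟩ fun h => hy ((memA ⟨y, hyv⟩).2 h)
    change G.Adj x y ↔ _ at this
    rw [this]
    constructor
    · rintro ⟨h1, h2⟩; exact ⟨⟨_, h1, rfl⟩, ⟨_, h2, rfl⟩⟩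
    · rintro ⟨⟨x', h1, rfl⟩, ⟨y', h2, rfl⟩⟩; exact ⟨h1, h2⟩
  have cA : 2 ≤ A.card :=
    one_lt_card.2 ⟨a₁, (memA _).2 ha₁, a₂, (memA _).2 ha₂, fun h => ha (Subtype.ext h)⟩
  have cB : 2 ≤ ((insert v A)ᶜ).card := by
    have aux : ∀ b ∈ Sᶜ, (b : V) ∈ (insert v A)ᶜ := fun b hb => by
      rw [mem_compl, mem_insert, memA]
      rintro (h | h)
      exacts [b.2 h, hb h]
    exact one_lt_card.2 ⟨b₁, aux _ hb₁, b₂, aux _ hb₂, fun h => hb (Subtype.ext h)⟩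
  have hdim := card_le_dimOn_add_two hadj
  have gen : ∀ a b, graphVec G (Pi.single a 1) b =
      ((Pi.single a 1 : V → ZMod 2) b, adjEntry G b a) := fun a b =>
    Prod.ext rfl (sum_adjEntry_single G a b)
  obtain ⟨c, hcG, hcA, hcv⟩ : ∃ c ∈ graphCode G, c ∈ supportedOn (insert v A) ∧ c v = (0, 1) := by
    -- Without such a vector, v has no neighbor in A outside A' and is adjacent to all or none of
    -- A'. Then v can be put on the other side, and the split extends to G.
    by_contra! hcon
    have h1 : ∀ a ∈ A, a ∉ A' → ¬ G.Adj v a := by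
      intro a ha haA' hva
      refine hcon _ (graphVec_mem G (Pi.single a 1)) (fun y hy => ?_) ?_
      · simp only [mem_insert, not_or] at hy
        have hya : y ≠ a := fun h => hy.2 (h ▸ ha)
        rw [gen, Pi.single_eq_of_ne hya, adjEntry_eq_zero_iff.2 fun h' =>
          haA' ((hadj a ha y hy.2 hy.1).1 h'.symm).1]
        rfl
      · have hva' : v ≠ a := hva.ne
        rw [gen, Pi.single_eq_of_ne hva', adjEntry_eq_one hva]
    have h2 : ∀ a ∈ A', ∀ a' ∈ A', G.Adj v a → G.Adj v a' := by
      intro a ha a' ha' hva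
      by_contra hva'
      refine hcon _ ((graphCode G).add_mem (graphVec_mem G (Pi.single a 1))
        (graphVec_mem G (Pi.single a' 1))) (fun y hy => ?_) ?_
      · simp only [mem_insert, not_or] at hy
        have hya : y ≠ a := fun h => hy.2 (h ▸ hA'A a ha)
        have hya' : y ≠ a' := fun h => hy.2 (h ▸ hA'A a' ha')
        have : adjEntry G y a = adjEntry G y a' := by
          by_cases hyB : y ∈ B'
          · rw [adjEntry_eq_one ((hadj a (hA'A a ha) y hy.2 hy.1).2 ⟨ha, hyB⟩).symm,
              adjEntry_eq_one ((hadj a' (hA'A a' ha') y hy.2 hy.1).2 ⟨ha', hyB⟩).symm]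
          · rw [adjEntry_eq_zero_iff.2 fun h => hyB ((hadj a (hA'A a ha) y hy.2 hy.1).1 h.symm).2,
              adjEntry_eq_zero_iff.2 fun h => hyB ((hadj a' (hA'A a' ha') y hy.2 hy.1).1 h.symm).2]
        rw [Pi.add_apply, gen, gen, Pi.single_eq_of_ne hya, Pi.single_eq_of_ne hya', this]
        exact (plane_add_eq_zero_iff _ _).2 rfl
      · have hne : v ≠ a' := fun h => hvA (h ▸ hA'A a' ha')
        rw [Pi.add_apply, gen, gen, Pi.single_eq_of_ne hva.ne, Pi.single_eq_of_ne hne,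
          adjEntry_eq_one hva, adjEntry_eq_zero_iff.2 hva']
        rfl
    refine hG (A : Set V) ⟨two_le_encard_iff.2 ⟨a₁, (memA _).2 ha₁, a₂, (memA _).2 ha₂,
      fun h => ha (Subtype.ext h)⟩, two_le_encard_iff.2 ⟨b₁, fun h => hb₁ ((memA _).1 h), b₂,
      fun h => hb₂ ((memA _).1 h), fun h => hb (Subtype.ext h)⟩, A', hA'A,
      {y | y ∈ B' ∨ (y = v ∧ ∃ a ∈ A', G.Adj v a)}, ?_, fun x hx y hy => ?_⟩
    · rintro y (hy | ⟨rfl, -⟩)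
      exacts [fun h => (hB'A y hy).1 h, hvA]
    · by_cases hyv : y = v
      · subst hyv
        simp only [Set.mem_ofPred_eq, true_and]
        constructor
        · intro h
          have hxA' : x ∈ A' := by
            by_contra hxA'
            exact h1 x hx hxA' h.symm
          exact ⟨hxA', Or.inr ⟨x, hxA', h.symm⟩⟩
        · rintro ⟨hxA', h | ⟨a, ha, h⟩⟩
          · exact absurd rfl (hB'A _ h).2
          · exact (h2 a ha x hxA' h).symm
      · rw [hadj x hx y hy hyv]
        simp [hyv]
  have hcv0 : c v ≠ 0 := by
    rw [hcv]; decide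
  have h3 : conn (graphCode G) A ≤ 2 := by
    unfold conn
    omega
  exact ⟨A, hvA, cA, cB, h3, (conn_insert_of_mem hvA hcG hcA hcv0).trans h3, ⟨c, hcG, hcA, hcv⟩,
    by decide⟩

lemma exists_adj_of_isSplitPrime {G : SimpleGraph V} (hG : G.IsSplitPrime)
    (hcard : 5 ≤ Fintype.card V) (v : V) : ∃ w, G.Adj v w := by
  by_contra! h
  obtain ⟨a, ha⟩ : ∃ a, a ≠ v := by
    have : Nontrivial V := Fintype.one_lt_card_iff_nontrivial.1 (by omega)
    exact exists_ne v
  have hc : 2 ≤ ({v, a}ᶜ : Finset V).card := by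
    have := card_add_card_compl ({v, a} : Finset V)
    rw [card_pair ha.symm] at this
    omega
  obtain ⟨b, hb, c, hc, hbc⟩ := one_lt_card.1 hc
  simp only [mem_compl, mem_insert, mem_singleton] at hb hc
  refine hG {v, a} ⟨two_le_encard_iff.2 ⟨v, by simp, a, by simp, ha.symm⟩,
    two_le_encard_iff.2 ⟨b, by simpa using hb, c, by simpa using hc, hbc⟩, {a}, by simp,
    {y | y ≠ v ∧ y ≠ a ∧ G.Adj a y}, fun y hy => ?_, fun x hx y hy => ?_⟩
  · simp [hy.1, hy.2.1]
  · simp only [Set.mem_compl_iff, Set.mem_insert_iff, Set.mem_singleton_iff, not_or] at hx hy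
    rcases hx with rfl | rfl
    · simp [h y, ha.symm]
    · simp [hy]

/-- Deletion corresponds to (0,1) at v; pulling this value back along G * v gives (1,1), and along
the pivot (1,0). So two non-prime minors give separations with different values. -/
lemma essential_of_not_isNonEssential {G : SimpleGraph V} (hG : G.IsSplitPrime)
    (hcard : 5 ≤ Fintype.card V) {v : V} (hv : ¬ G.IsNonEssential v) :
    Essential (graphCode G) v := by
  have h1 : ¬ (G.deleteVertex v).IsSplitPrime → ∃ A, Sep (graphCode G) v (0, 1) A :=
    exists_sep_of_not_isSplitPrime hG
  have h2 : ¬ ((G.localComplement v).deleteVertex v).IsSplitPrime →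
      ∃ A, Sep (graphCode G) v (1, 1) A := by
    intro h
    obtain ⟨A, hA⟩ := exists_sep_of_not_isSplitPrime (isSplitPrime_localComplement hG v) h
    refine ⟨A, ?_⟩
    convert (codeEquiv_localComplement G v).sep hA using 1
    rw [complementEquiv_symm, complementEquiv_apply, adjEntry_self, if_pos rfl]
    decide
  have h3 : ¬ (G.contractVertex v).IsSplitPrime → ∃ A, Sep (graphCode G) v (1, 0) A := by
    intro h
    have hw := exists_adj_of_isSplitPrime hG hcard v
    rw [contractVertex, dif_pos hw] at h
    have hvw := hw.choose_spec
    set w := hw.choose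
    clear_value w
    have p1 := isSplitPrime_localComplement hG v
    have p2 := isSplitPrime_localComplement p1 w
    obtain ⟨A, hA⟩ := exists_sep_of_not_isSplitPrime (isSplitPrime_localComplement p2 v) h
    refine ⟨A, ?_⟩
    convert (codeEquiv_localComplement G v).sep
      ((codeEquiv_localComplement _ w).sep ((codeEquiv_localComplement _ v).sep hA)) using 1
    have hne : v ≠ w := hvw.ne
    have hadj : (G.localComplement v).Adj w v := (localComplement_adj_self.2 hvw).symm
    simp only [complementEquiv_symm, complementEquiv_apply, adjEntry_self, if_true, if_neg hne,
      adjEntry_eq_one hadj]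
    decide
  unfold IsNonEssential at hv
  by_cases c1 : (G.deleteVertex v).IsSplitPrime
  · by_cases c2 : ((G.localComplement v).deleteVertex v).IsSplitPrime
    · exact absurd (Or.inl ⟨c1, c2⟩) hv
    · by_cases c3 : (G.contractVertex v).IsSplitPrime
      · exact absurd (Or.inr (Or.inl ⟨c1, c3⟩)) hv
      · obtain ⟨A, hA⟩ := h2 c2
        obtain ⟨B, hB⟩ := h3 c3
        exact ⟨_, _, A, B, by decide, hA, hB⟩
  · obtain ⟨A, hA⟩ := h1 c1
    by_cases c2 : ((G.localComplement v).deleteVertex v).IsSplitPrime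
    · by_cases c3 : (G.contractVertex v).IsSplitPrime
      · exact absurd (Or.inr (Or.inr ⟨c2, c3⟩)) hv
      · obtain ⟨B, hB⟩ := h3 c3
        exact ⟨_, _, A, B, by decide, hA, hB⟩
    · obtain ⟨B, hB⟩ := h2 c2
      exact ⟨_, _, A, B, by decide, hA, hB⟩

/-- A prime graph with at most two non-essential vertices is locally equivalent to a graph in
which all vertices but two have degree two. -/
lemma exists_locallyEquivalent_degree_two {G : SimpleGraph V} (hG : G.IsSplitPrime)
    (hcard : 5 ≤ Fintype.card V) (hness : {v : V | G.IsNonEssential v}.ncard ≤ 2) :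
    ∃ (H : SimpleGraph V) (x y : V), G.LocallyEquivalent H ∧ x ≠ y ∧
      ∀ v, v ≠ x → v ≠ y → ∃ p q, p ≠ q ∧ ∀ w, H.Adj v w ↔ w = p ∨ w = q := by
  have hL := isPrimeCode_graphCode hG hcard
  have hN : {v | ¬ Essential (graphCode G) v}.ncard ≤ 2 :=
    (Set.ncard_le_ncard (fun v hv => by
      by_contra h
      exact hv (essential_of_not_isNonEssential hG hcard h)) (Set.toFinite _)).trans hness
  obtain ⟨ζ, x, y, hxy, h0, hζ⟩ := hL.hasThetaBasis hN
  -- If c v = ζ v for some v other than x, y, the vector t on the triple of v would fail to commute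
  -- with c at v alone, as it agrees with ζ at its other points. So c lives on x, y and vanishes.
  have havoid : Avoids (graphCode G) ζ := by
    intro c hc hcζ
    have key : ∀ v, v ≠ x → v ≠ y → c v = 0 := by
      intro v hvx hvy
      by_contra hcv
      obtain ⟨t, p, q, ht, hv, hp, hq⟩ := hζ v hvx hvy
      have hcv' : c v = ζ v := (hcζ v).resolve_left hcv
      obtain ⟨w, hw, h1, h2, h3⟩ := hL.lagrangian.exists_ne hc ht.mem hcv ht.apply_ne
        (by rw [hcv']; exact hv.symm)
      have h4 := (hcζ w).resolve_left h1
      rcases (ht.supp w).1 h2 with rfl | rfl | rfl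
      · exact hw rfl
      · exact h3 (h4.trans hp.symm)
      · exact h3 (h4.trans hq.symm)
    by_contra hc0
    have := hL.three_le_card_of_supportedOn hc hc0 (A := {x, y}) fun v hv => by
      simp only [mem_insert, mem_singleton, not_or] at hv
      exact key v hv.1 hv.2
    rw [card_pair hxy] at this
    omega
  obtain ⟨H, σ, hGH, hσ, hσζ⟩ := exists_locallyEquivalent G ζ h0 havoid
  refine ⟨H, x, y, hGH, hxy, fun v hvx hvy => ?_⟩
  obtain ⟨t, p, q, ht, hv, hp, hq⟩ := hζ v hvx hvy
  refine ⟨p, q, ht.ne₂₃, fun w => ?_⟩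
  -- After the transformation only v has a nonzero first coordinate, so the vector is the row of v
  -- and its second coordinates list the neighbors of v.
  have hc := (hσ t).1 ht.mem
  have cp : σ p (t p) = (0, 1) := by rw [hp, hσζ]
  have cq : σ q (t q) = (0, 1) := by rw [hq, hσζ]
  have c0 : ∀ u, u ≠ v → u ≠ p → u ≠ q → σ u (t u) = 0 := fun u h1 h2 h3 => by
    rw [ht.eq_zero h1 h2 h3, map_zero]
  have cv : (σ v (t v)).1 = 1 := by
    have aux : ∀ z : Plane, z ≠ 0 → z ≠ (0, 1) → z.1 = 1 := by decide
    refine aux _ (by simpa using ht.apply_ne) fun h => hv ?_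
    rw [← hσζ v] at h
    exact (σ v).injective h
  have hfst : ∀ u, u ≠ v → (σ u (t u)).1 = 0 := by
    intro u huv
    by_cases h1 : u = p
    · rw [h1, cp]
    by_cases h2 : u = q
    · rw [h2, cq]
    rw [c0 u huv h1 h2]; rfl
  have hsnd : ∀ u, (σ u (t u)).2 = adjEntry H u v := by
    intro u
    rw [mem_graphCode] at hc
    rw [hc u, sum_eq_single v]
    · rw [cv, mul_one]
    · intro b _ hb
      rw [hfst b hb, mul_zero]
    · simp
  rw [H.adj_comm, ← adjEntry_eq_one_iff, ← hsnd]
  by_cases h1 : w = p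
  · simp [h1, cp]
  by_cases h2 : w = q
  · simp [h2, cq]
  simp only [h1, h2, or_self, iff_false]
  by_cases h3 : w = v
  · rw [h3, hsnd, adjEntry_self]; decide
  · rw [c0 w h3 h1 h2]; decide

end Prime

/-! ### Threads and theta graphs -/

variable {V : Type u}

/-- `p 0, …, p l` is a path from `x` to `y` in `H` with first step `u`, all of whose internal
vertices have no further neighbors. -/
structure IsThread (H : SimpleGraph V) (x y u : V) (l : ℕ) (p : ℕ → V) : Prop where
  one_le : 1 ≤ l
  zero : p 0 = x
  one : p 1 = u
  last : p l = y
  inner : ∀ k, k + 1 < l → p (k + 1) ≠ x ∧ p (k + 1) ≠ y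
  adj : ∀ k, k < l → H.Adj (p k) (p (k + 1))
  eq_or_eq : ∀ k, k + 1 < l → ∀ w, H.Adj (p (k + 1)) w → w = p k ∨ w = p (k + 2)
  ne : ∀ k, k + 1 < l → p k ≠ p (k + 2)

namespace IsThread

variable {H : SimpleGraph V} {x y u u' : V} {l l' : ℕ} {p p' : ℕ → V}

/-- Trace both threads backwards: degree two forces equal predecessors until both reach x at the
same time. -/
lemma eq_of_same (h : IsThread H x y u l p) (h' : IsThread H x y u' l' p') :
    ∀ i j, i + 1 < l → j + 1 < l' → p (i + 1) = p' (j + 1) → p (i + 2) = p' (j + 2) →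
      i = j ∧ u = u' := by
  intro i
  induction i with
  | zero =>
    intro j hi hj h1 h2
    have h3 := h'.eq_or_eq j hj (p 0) (by rw [← h1]; exact (h.adj 0 (by omega)).symm)
    rcases h3 with h3 | h3
    · rcases j with _ | j
      · exact ⟨rfl, by rw [← h.one, ← h'.one, h1]⟩
      · exact absurd (h3.symm.trans h.zero) (h'.inner j (by omega)).1
    · exact absurd (h3.trans h2.symm) (h.ne 0 hi)
  | succ i ih =>
    intro j hi hj h1 h2
    have h3 := h'.eq_or_eq j hj (p (i + 1)) (by rw [← h1]; exact (h.adj (i + 1) (by omega)).symm)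
    rcases h3 with h3 | h3
    · rcases j with _ | j
      · exact absurd (h3.trans h'.zero) (h.inner i (by omega)).1
      · obtain ⟨rfl, h4⟩ := ih j (by omega) (by omega) h3 h1
        exact ⟨rfl, h4⟩
    · exact absurd (h3.trans h2.symm) (h.ne (i + 1) hi)

/-- Follow one thread backwards and the other forwards. They stay together until the first arrives
at x, which the second can meet neither inside nor at its end y. -/
lemma false_of_opposite (hxy : x ≠ y) (h : IsThread H x y u l p)
    (h' : IsThread H x y u' l' p') :
    ∀ i j, i + 1 < l → j + 1 < l' → p (i + 1) = p' (j + 1) → p i = p' (j + 2) → False := by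
  intro i
  induction i with
  | zero =>
    intro j hi hj h1 h2
    rw [h.zero] at h2
    by_cases hj' : j + 2 < l'
    · exact (h'.inner (j + 1) hj').1 h2.symm
    · have : j + 2 = l' := by omega
      rw [this, h'.last] at h2
      exact hxy h2
  | succ i ih =>
    intro j hi hj h1 h2
    have hj' : j + 2 < l' := by
      by_contra hcon
      have : j + 2 = l' := by omega
      rw [this, h'.last] at h2
      exact (h.inner i (by omega)).2 h2
    have h3 := h'.eq_or_eq (j + 1) hj' (p i)
      (by rw [← h2]; exact (h.adj i (by omega)).symm)
    rcases h3 with h3 | h3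
    · exact h.ne i (by omega) (h3.trans h1.symm)
    · exact ih (j + 1) (by omega) hj' h2 h3

lemma eq_of_apply_eq (hxy : x ≠ y) (h : IsThread H x y u l p)
    (h' : IsThread H x y u' l' p') {i j : ℕ} (hi : i + 1 < l) (hj : j + 1 < l')
    (hij : p (i + 1) = p' (j + 1)) : i = j ∧ u = u' := by
  have h1 := h'.eq_or_eq j hj (p i) (by rw [← hij]; exact (h.adj i (by omega)).symm)
  rcases h1 with h1 | h1
  · have h2 := h'.eq_or_eq j hj (p (i + 2)) (by rw [← hij]; exact h.adj (i + 1) hi)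
    rcases h2 with h2 | h2
    · exact absurd (h1.trans h2.symm) (h.ne i hi)
    · exact h.eq_of_same h' i j hi hj hij h2
  · exact (h.false_of_opposite hxy h' i j hi hj hij h1).elim

end IsThread

section Degree

variable [Fintype V] {H : SimpleGraph V} {x y : V}

/-- A set of vertices of degree two has neighbors at both ends. -/
lemma false_of_closed (hH : H.IsSplitPrime) (hcard : 5 ≤ Fintype.card V) {z z' : V}
    (hz : z ≠ z') {C : Set V} (hne : C.Nonempty) (hzC : z ∉ C) (hz'C : z' ∉ C)
    (hC : ∀ v ∈ C, ∀ w, H.Adj v w → w ∈ C ∨ w = z) : False := by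
  classical
  obtain ⟨c, hc⟩ := hne
  -- With a further vertex outside, z separates C from the rest, so C together with z is one side of
  -- a split. Otherwise z' has no neighbor but possibly z, and the pair z, z' is one side of a
  -- split.
  by_cases hu : ∃ u, u ∉ C ∧ u ≠ z ∧ u ≠ z'
  · obtain ⟨u, hu, huz, huz'⟩ := hu
    refine hH (insert z C) ⟨two_le_encard_iff.2 ⟨z, by simp, c, by simp [hc],
      fun h => hzC (h ▸ hc)⟩, two_le_encard_iff.2 ⟨u, by simp [hu, huz], z',
      by simp [hz'C, hz.symm], huz'⟩, {z}, by simp, {w | w ∉ insert z C ∧ H.Adj z w},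
      fun w hw => hw.1, fun v hv w hw => ?_⟩
    by_cases hvz : v = z
    · subst hvz
      exact ⟨fun h => ⟨rfl, hw, h⟩, fun h => h.2.2⟩
    · have hvC : v ∈ C := by simpa [hvz] using hv
      have : ¬ H.Adj v w := fun h => hw (by
        rcases hC v hvC w h with h | h
        · exact Or.inr h
        · exact Or.inl h)
      simp [this, hvz]
  · push Not at hu
    obtain ⟨a, ha, b, hb, hab⟩ := one_lt_card.1
      (show 1 < ({z, z'}ᶜ : Finset V).card by
        have := card_add_card_compl ({z, z'} : Finset V)
        rw [card_pair hz] at this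
        omega)
    have hCz' : ∀ v ∈ C, ¬ H.Adj z' v := fun v hv h => by
      rcases hC v hv z' h.symm with h | h
      · exact hz'C h
      · exact hz h.symm
    refine hH {z, z'} ⟨two_le_encard_iff.2 ⟨z, by simp, z', by simp, hz⟩,
      two_le_encard_iff.2 ⟨a, by simpa using ha, b, by simpa using hb, hab⟩, {z}, by simp,
      {w | w ∈ C ∧ H.Adj z w}, fun w hw => ?_, fun v hv w hw => ?_⟩
    · simp only [Set.mem_compl_iff, Set.mem_insert_iff, Set.mem_singleton_iff]
      rintro (rfl | rfl)
      exacts [hzC hw.1, hz'C hw.1]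
    · have hwC : w ∈ C := by
        by_contra h
        simp only [Set.mem_compl_iff, Set.mem_insert_iff, Set.mem_singleton_iff, not_or] at hw
        exact hw.2 (hu w h hw.1)
      rcases hv with rfl | rfl
      · simp [hwC]
      · simp [hCz' w hwC, hz.symm]

open Classical in
/-- A neighbor of `b` different from `a`, if there is one. -/
noncomputable def nextVertex (H : SimpleGraph V) (a b : V) : V :=
  if h : ∃ c, c ≠ a ∧ H.Adj b c then h.choose else b

/-- The sequence of vertices which starts with `x`, `u` and avoids turning back. -/
noncomputable def walkFrom (H : SimpleGraph V) (x u : V) : ℕ → V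
  | 0 => x
  | 1 => u
  | n + 2 => nextVertex H (walkFrom H x u n) (walkFrom H x u (n + 1))

lemma nextVertex_spec {a b : V} (hb : ∃ p q, p ≠ q ∧ ∀ w, H.Adj b w ↔ w = p ∨ w = q)
    (hab : H.Adj b a) : a ≠ nextVertex H a b ∧
      ∀ w, H.Adj b w ↔ w = a ∨ w = nextVertex H a b := by
  obtain ⟨p, q, hpq, hw⟩ := hb
  have hex : ∃ c, c ≠ a ∧ H.Adj b c := by
    rcases (hw a).1 hab with rfl | rfl
    · exact ⟨q, hpq.symm, (hw q).2 (Or.inr rfl)⟩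
    · exact ⟨p, hpq, (hw p).2 (Or.inl rfl)⟩
  rw [nextVertex, dif_pos hex]
  obtain ⟨h1, h2⟩ := hex.choose_spec
  refine ⟨h1.symm, fun w => ?_⟩
  rw [hw]
  rcases (hw a).1 hab with ha | ha <;> rcases (hw _).1 h2 with hc | hc
  · exact absurd (hc.trans ha.symm) h1
  · rw [hc, ha]
  · rw [hc, ha, or_comm]
  · exact absurd (hc.trans ha.symm) h1

variable (hxy : x ≠ y)
  (hdeg : ∀ v, v ≠ x → v ≠ y → ∃ p q, p ≠ q ∧ ∀ w, H.Adj v w ↔ w = p ∨ w = q)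

include hdeg in
lemma walkFrom_spec {u : V} (hu : H.Adj x u) (n : ℕ)
    (hn : ∀ k, k < n → walkFrom H x u (k + 1) ≠ x ∧ walkFrom H x u (k + 1) ≠ y) :
    H.Adj (walkFrom H x u n) (walkFrom H x u (n + 1)) := by
  induction n with
  | zero => exact hu
  | succ n ih =>
    have h1 := ih fun k hk => hn k (by omega)
    have h2 := hn n (by omega)
    exact ((nextVertex_spec (hdeg _ h2.1 h2.2) h1.symm).2 _).2 (Or.inr rfl)

include hxy hdeg in
-- The walk that never turns back must end at x or y: degree two makes it reversible, so a
-- repetition would trace back to x. A return to x would enclose a set attached to the rest only at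
-- x, against primality.
lemma exists_isThread (hH : H.IsSplitPrime) (hcard : 5 ≤ Fintype.card V) {u : V}
    (hu : H.Adj x u) : ∃ l p, IsThread H x y u l p := by
  classical
  set p := walkFrom H x u with hp
  have hspec : ∀ k, (∀ i, i < k + 1 → p (i + 1) ≠ x ∧ p (i + 1) ≠ y) →
      p k ≠ p (k + 2) ∧ ∀ w, H.Adj (p (k + 1)) w ↔ w = p k ∨ w = p (k + 2) := by
    intro k hk
    have h1 := walkFrom_spec hdeg hu k fun i hi => hk i (by omega)
    have h2 := hk k (by omega)
    exact nextVertex_spec (hdeg _ h2.1 h2.2) h1.symm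
  have hit : ∃ k, p (k + 1) = x ∨ p (k + 1) = y := by
    by_contra! hno
    have hback : ∀ i j, i < j → p i = p j → p (i + 1) = p (j + 1) → False := by
      intro i
      induction i with
      | zero =>
        intro j hj h1 _
        obtain ⟨j, rfl⟩ : ∃ j', j = j' + 1 := ⟨j - 1, by omega⟩
        exact (hno j).1 h1.symm
      | succ i ih =>
        intro j hj h1 h2
        obtain ⟨j, rfl⟩ : ∃ j', j = j' + 1 := ⟨j - 1, by omega⟩
        have h3 := hspec i fun k _ => hno k
        have h4 := hspec j fun k _ => hno k
        have h5 := (h3.2 (p i)).2 (Or.inl rfl)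
        rw [h1, h4.2] at h5
        rcases h5 with h5 | h5
        · exact ih j (by omega) h5 h1
        · exact h3.1 (h5.trans h2.symm)
    obtain ⟨i, j, hij, h⟩ := Finite.exists_ne_map_eq_of_infinite fun n => (p n, p (n + 1))
    simp only [Prod.mk.injEq] at h
    rcases lt_or_gt_of_ne hij with h' | h'
    · exact hback i j h' h.1 h.2
    · exact hback j i h' h.1.symm h.2.symm
  set n := Nat.find hit with hn
  have hmin : ∀ k, k < n → p (k + 1) ≠ x ∧ p (k + 1) ≠ y := fun k hk => by
    have := Nat.find_min hit hk
    tauto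
  have hlast : p (n + 1) = y := by
    rcases Nat.find_spec hit with h | h
    · exfalso
      have hn0 : n ≠ 0 := by
        intro h0
        rw [← hn, h0] at h
        exact hu.ne h.symm
      refine false_of_closed hH hcard hxy (C := {v | ∃ k, k < n ∧ p (k + 1) = v})
        ⟨_, 0, by omega, rfl⟩ ?_ ?_ ?_
      · rintro ⟨k, hk, h⟩
        exact (hmin k hk).1 h
      · rintro ⟨k, hk, h⟩
        exact (hmin k hk).2 h
      · rintro _ ⟨k, hk, rfl⟩ w hw
        have h2 := hspec k fun i hi => hmin i (by omega)
        rcases (h2.2 w).1 hw with rfl | rfl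
        · rcases k with _ | k
          · exact Or.inr rfl
          · exact Or.inl ⟨k, by omega, rfl⟩
        · by_cases hk' : k + 1 < n
          · exact Or.inl ⟨k + 1, hk', rfl⟩
          · have : k + 1 = n := by omega
            right
            rw [← h, ← hn, ← this]
    · exact h
  refine ⟨n + 1, p, by omega, rfl, rfl, hlast, fun k hk => hmin k (by omega), fun k hk => ?_,
    fun k hk w hw => ?_, fun k hk => (hspec k fun i hi => hmin i (by omega)).1⟩
  · exact walkFrom_spec hdeg hu k fun i hi => hmin i (by omega)
  · exact ((hspec k fun i hi => hmin i (by omega)).2 w).1 hw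

include hxy hdeg in
/-- A prime graph in which all vertices but two have degree two is a theta graph. -/
theorem exists_iso_thetaGraph (hH : H.IsSplitPrime) (hcard : 5 ≤ Fintype.card V) :
    ∃ (m : ℕ) (ℓ : Fin m → ℕ), 1 ≤ m ∧ (∀ i, 1 ≤ ℓ i) ∧
        {i : Fin m | ℓ i = 1}.ncard ≤ 1 ∧ Nonempty (H ≃g thetaGraph ℓ) := by
  classical
  -- One path for each neighbor of x.
  let e := (Fintype.equivFin {u // H.Adj x u}).symm
  have H0 : ∀ i, ∃ l p, IsThread H x y (e i) l p := fun i =>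
    exists_isThread hxy hdeg hH hcard (e i).2
  choose ℓ p hp using H0
  have he : ∀ v, H.Adj x v → ∃ i, p i 1 = v := fun v hv =>
    ⟨e.symm ⟨v, hv⟩, by rw [(hp _).one, Equiv.apply_symm_apply]⟩
  let φ : ThetaVertex ℓ → V := fun a => match a with
    | Sum.inl false => x
    | Sum.inl true => y
    | Sum.inr ⟨i, j⟩ => p i (j + 1)
  have hφ : ∀ i j, j ≤ ℓ i → φ (thetaPathVertex ℓ i j) = p i j := by
    intro i j hj
    unfold thetaPathVertex
    by_cases h0 : j = 0
    · rw [if_pos h0, h0]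
      exact (hp i).zero.symm
    rw [if_neg h0]
    by_cases h1 : j - 1 < ℓ i - 1
    · rw [dif_pos h1]
      change p i (j - 1 + 1) = p i j
      rw [Nat.sub_add_cancel (by omega)]
    · rw [dif_neg h1]
      have := (hp i).one_le
      have : j = ℓ i := by omega
      rw [this]
      exact (hp i).last.symm
  have hinner : ∀ i (j : Fin (ℓ i - 1)), p i (j + 1) ≠ x ∧ p i (j + 1) ≠ y := fun i j =>
    (hp i).inner j (by have := j.2; omega)
  have hinj : Function.Injective φ := by
    intro a b hab
    rcases a with (_ | _) | ⟨i, j⟩ <;> rcases b with (_ | _) | ⟨i', j'⟩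
    · rfl
    · exact absurd hab hxy
    · exact absurd hab.symm (hinner i' j').1
    · exact absurd hab.symm hxy
    · rfl
    · exact absurd hab.symm (hinner i' j').2
    · exact absurd hab (hinner i j).1
    · exact absurd hab (hinner i j).2
    · obtain ⟨h1, h2⟩ := (hp i).eq_of_apply_eq hxy (hp i') (by have := j.2; omega)
        (by have := j'.2; omega) hab
      obtain rfl := e.injective (Subtype.ext h2)
      rw [Fin.ext h1]
  have hsurj : Function.Surjective φ := by
    intro v
    by_contra! hv
    -- All neighbors of x and of the inner vertices lie on threads, so the uncovered vertices could
    -- be attached only at y.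
    refine false_of_closed hH hcard hxy.symm (C := {v | ∀ a, φ a ≠ v}) ⟨v, hv⟩
      (fun h => h (Sum.inl true) rfl) (fun h => h (Sum.inl false) rfl) fun v hv w hvw => ?_
    by_contra! hcon
    obtain ⟨hw, hwy⟩ := hcon
    have hw' : ∃ a, φ a = w := by
      by_contra! h
      exact hw h
    obtain ⟨(_ | _) | ⟨i, j⟩, rfl⟩ := hw'
    · obtain ⟨i, rfl⟩ := he v hvw.symm
      exact hv _ (hφ i 1 (hp i).one_le)
    · exact hwy rfl
    · have hj := j.2
      rcases (hp i).eq_or_eq j (by omega) v hvw.symm with h | h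
      · exact hv _ ((hφ i j (by omega)).trans h.symm)
      · exact hv _ ((hφ i (j + 2) (by omega)).trans h.symm)
  have hsucc : ∀ i (j : Fin (ℓ i - 1)), thetaPathVertex ℓ i (j + 1) = Sum.inr ⟨i, j⟩ := by
    intro i j
    have hj := j.2
    exact hinj ((hφ i (j + 1) (by omega)).trans rfl)
  have hnbr : ∀ a v, a ≠ Sum.inl true → H.Adj (φ a) v → ∃ b, φ b = v ∧ (thetaGraph ℓ).Adj a b := by
    intro a v ha hav
    have step : ∀ i j, j < ℓ i → (thetaGraph ℓ).Adj (thetaPathVertex ℓ i j)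
        (thetaPathVertex ℓ i (j + 1)) := by
      intro i j hj
      rw [thetaGraph, fromRel_adj]
      refine ⟨fun h => ?_, Or.inl ⟨i, j, hj, rfl, rfl⟩⟩
      have h1 := congrArg φ h
      rw [hφ i j (by omega), hφ i (j + 1) (by omega)] at h1
      exact ((hp i).adj j hj).ne h1
    rcases a with (_ | _) | ⟨i, j⟩
    · obtain ⟨i, rfl⟩ := he v hav
      have := (hp i).one_le
      refine ⟨thetaPathVertex ℓ i 1, hφ i 1 (hp i).one_le, ?_⟩
      simpa [thetaPathVertex] using step i 0 (by omega)
    · exact absurd rfl ha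
    · have hj := j.2
      rcases (hp i).eq_or_eq j (by omega) v hav with rfl | rfl
      · refine ⟨thetaPathVertex ℓ i j, hφ i j (by omega), ?_⟩
        rw [← hsucc]
        exact (step i j (by omega)).symm
      · refine ⟨thetaPathVertex ℓ i (j + 2), hφ i _ (by omega), ?_⟩
        rw [← hsucc]
        exact step i (j + 1) (by omega)
  have hadj : ∀ a b, H.Adj (φ a) (φ b) ↔ (thetaGraph ℓ).Adj a b := by
    intro a b
    constructor
    · intro h
      by_cases ha : a = Sum.inl true
      · by_cases hb : b = Sum.inl true
        · rw [ha, hb] at h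
          exact absurd rfl h.ne
        · obtain ⟨c, hc, h'⟩ := hnbr b (φ a) hb h.symm
          rw [← hinj hc]
          exact h'.symm
      · obtain ⟨c, hc, h'⟩ := hnbr a (φ b) ha h
        rwa [← hinj hc]
    · rw [thetaGraph, fromRel_adj]
      rintro ⟨-, ⟨i, j, hj, rfl, rfl⟩ | ⟨i, j, hj, rfl, rfl⟩⟩
      · rw [hφ i j (by omega), hφ i (j + 1) (by omega)]
        exact (hp i).adj j hj
      · rw [hφ i j (by omega), hφ i (j + 1) (by omega)]
        exact ((hp i).adj j hj).symm
  refine ⟨_, ℓ, ?_, fun i => (hp i).one_le, ?_, ⟨RelIso.symm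
    ⟨Equiv.ofBijective φ ⟨hinj, hsurj⟩, fun {a b} => hadj a b⟩⟩⟩
  · obtain ⟨v, hv⟩ := exists_adj_of_isSplitPrime hH hcard x
    exact (e.symm ⟨v, hv⟩).pos
  · rw [Set.ncard_le_one (Set.toFinite _)]
    -- A thread of length one has first step y, and distinct threads have distinct first steps.
    have hone : ∀ i, ℓ i = 1 → (e i : V) = y := fun i hi => by
      rw [← (hp i).one, ← (hp i).last, hi]
    intro i hi j hj
    exact e.injective (Subtype.ext ((hone i hi).trans (hone j hj).symm))

end Degree

end PrimeVertexMinor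

theorem mainTheorem7 {V : Type u} [Fintype V] (G : SimpleGraph V)
    (hcard : 5 ≤ Fintype.card V) (hprime : G.IsSplitPrime)
    (hness : {v : V | G.IsNonEssential v}.ncard ≤ 2) :
    ∃ H : SimpleGraph V, G.LocallyEquivalent H ∧
      ∃ (m : ℕ) (ℓ : Fin m → ℕ), 1 ≤ m ∧ (∀ i, 1 ≤ ℓ i) ∧
        {i : Fin m | ℓ i = 1}.ncard ≤ 1 ∧
        Nonempty (H ≃g SimpleGraph.thetaGraph ℓ) := by
  classical
  obtain ⟨H, x, y, hGH, hxy, hdeg⟩ :=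
    PrimeVertexMinor.exists_locallyEquivalent_degree_two hprime hcard hness
  exact ⟨H, hGH, PrimeVertexMinor.exists_iso_thetaGraph hxy hdeg
    (PrimeVertexMinor.isSplitPrime_of_locallyEquivalent hprime hGH) hcard⟩
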